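/- **Setting.** Let $K$ be a field, $F\supseteq K$ a field, and $B=\prod_{k\ge 0}B_k$ the completion of a commutative graded $F$-algebra $\bigoplus_{k\ge0} B_k$ with $B_0=F$ (with respect to the filtration by degree). Assume that $B$ has no zero divisors. For an $F$-algebra $S$ write $S\otimes B$ for the completed tensor product $\prod_k S\otimes_F B_k$. A *higher derivation* of $S$ into $S\otimes B$ is a ring homomorphism $\theta_S=\sum_k\theta_S^{(k)}:S\to S\otimes B$, with $\theta_S^{(k)}:S\to S\otimes_F B_k$ and $\theta_S^{(0)}=\mathrm{id}_S$. It is *iterable* if the components $S\otimes_F B_k$ are generated by the elements $\theta_S^{(k)}(s)$ (that is, these elements generate the graded algebra $\bigoplus_k S\otimes_F B_k$ as an $S$-algebra) and $\theta_S$ extends to a continuous ring endomorphism of $S\otimes B$ which does not lower degrees and whose homogeneous components, denoted $\theta_S^{(i)}$ again ($i\ge0$, raising degrees by $i$), satisfy $\theta_S^{(i)}\circ\theta_S^{(j)}=\binom{i+j}{i}\theta_S^{(i+j)}$ for all $i,j\geq 0$. Fix an iterable higher derivation $\theta:F\to B$ with $K=\{t\in F\mid\theta(t)=t\}$. A *$\theta$-ring*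 is a commutative $F$-algebra $R$ with an iterable higher derivation $\theta_R:R\to R\otimes B$ extending $\theta$. Its ring of constants is $C_R=\{r\in R\mid\theta_R(r)=r\otimes1\}$. A *$\theta$-ideal* is an ideal $I$ with $\theta_R^{(k)}(I)\subseteq I\otimes_F B_k$ for all $k$, and $R$ is *$\theta$-simple* if $R\neq0$ and its only $\theta$-ideals are $0$ and $R$. An *iterable higher differential equation* $\theta(y)=Ay$ is given by a matrix $A=\sum_kA_k\in \mathrm{GL}_n(B)$ (with $A_k$ having entries in $B_k$) such that $A_0=1$ and $\binom{k+l}{l}A_{k+l}=\sum_{i+j=l}\theta^{(i)}(A_k)A_j$ for all $k,l\geq 0$. A *PPV-ring* (pseudo Picard–Vessiot ring) for it is a $\theta$-simple $\theta$-ring $R$ with $C_R=K$ and with a matrix $Y\in \mathrm{GL}_n(R)$ satisfying $\theta_R(Y)=AY$ such that $R$ is generated as an $F$-algebra by the entries of $Y$ and $\det(Y)^{-1}$. A *PPV-extension* $E/F$ is given by the quotient field $E$ of a PPV-ring $R$. Its *Galois group scheme* $\mathcal G=\underline{\mathrm{Gal}}(E/F)$ is the group functor $$L\longmapsto \mathrm{Aut}^{\theta}(R\otimes_KL\,/\,F\otimes_KL)$$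 on commutative $K$-algebras $L$: the group of $F\otimes_KL$-algebra automorphisms of $R\otimes_KL$ commuting with the higher derivation $r\otimes a\mapsto\theta_R(r)\otimes a$. A group functor on commutative $K$-algebras is an *infinitesimal group scheme* over $K$ if it is represented by a finite-dimensional commutative $K$-algebra whose augmentation ideal (the kernel of the homomorphism to $K$ given by the neutral element) is nilpotent. **Corollary.** Let $E/F$ be a PPV-extension with Galois group scheme $\mathcal G$. Then $E/F$ is purely inseparable if and only if $\mathcal G$ is an infinitesimal group scheme. -/

import Mathlib

open scoped TensorProduct PowerSeries

universe u

noncomputable section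

namespace PPV

section Cga

variable {S B : Type u} [CommRing S] [CommRing B] [Algebra S B]

/-- The completion of a graded algebra `B = ⨁ 𝓑 k` with respect to the filtration by the ideals
`⨁_{i ≥ k} 𝓑 i`. As a module it is `∏ 𝓑 k`; it is realised here as the algebra of those power
series `∑ bₖ Xᵏ` over `B` with `bₖ ∈ 𝓑 k`, the variable `X` only recording degrees (so the element
`∑ bₖ` of the completion is the power series `∑ bₖ Xᵏ`). -/
def Cga (𝓑 : ℕ → Submodule S B) [GradedAlgebra 𝓑] : Subalgebra S B⟦X⟧ where
  carrier := {f | ∀ k, PowerSeries.coeff k f ∈ 𝓑 k}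
  mul_mem' {f g} hf hg k := by
    rw [PowerSeries.coeff_mul]
    refine Submodule.sum_mem _ fun p hp => ?_
    rw [← Finset.HasAntidiagonal.mem_antidiagonal.mp hp]
    exact SetLike.mul_mem_graded (hf p.1) (hg p.2)
  add_mem' {f g} hf hg k := by
    rw [map_add]
    exact Submodule.add_mem _ (hf k) (hg k)
  algebraMap_mem' s k := by
    rw [PowerSeries.algebraMap_apply, PowerSeries.coeff_C]
    split_ifs with h
    · subst h
      exact SetLike.algebraMap_mem_graded 𝓑 s
    · exact Submodule.zero_mem _

namespace Cga

variable (𝓑 : ℕ → Submodule S B) [GradedAlgebra 𝓑]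

/-- The projection `prₖ` of the completion to its `k`-th homogeneous component. -/
def pr (k : ℕ) (f : Cga 𝓑) : 𝓑 k := ⟨PowerSeries.coeff k f.1, f.2 k⟩

/-- The inclusion of the `k`-th homogeneous component into the completion. -/
def single (k : ℕ) (b : 𝓑 k) : Cga 𝓑 :=
  ⟨PowerSeries.monomial k b.1, fun j => by
    rw [PowerSeries.coeff_monomial]
    split_ifs with h
    · subst h
      exact b.2
    · exact Submodule.zero_mem _⟩

variable {𝓑}

/-- The restriction `𝓑 k → 𝓑 (i + k)` of the homogeneous component `g⁽ⁱ⁾` of an endomorphism `g`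
of the completion, that is `b ↦ pr_{i+k} (g b)`. -/
def homComp (g : Cga 𝓑 →+* Cga 𝓑) (i k : ℕ) (b : 𝓑 k) : 𝓑 (i + k) :=
  pr 𝓑 (i + k) (g (single 𝓑 k b))

/-- `g` is a positive continuous endomorphism: it is compatible with the filtration of the
completion by the ideals `∏_{j ≥ k} 𝓑 j`. -/
def IsPositive (g : Cga 𝓑 →+* Cga 𝓑) : Prop :=
  ∀ (k : ℕ) (b : Cga 𝓑), (∀ j < k, pr 𝓑 j b = 0) → ∀ j < k, pr 𝓑 j (g b) = 0

/-- The homomorphism between completions induced by a homomorphism of graded rings. -/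
def map {S' B' : Type u} [CommRing S'] [CommRing B'] [Algebra S' B']
    (𝓑 : ℕ → Submodule S B) [GradedAlgebra 𝓑] (𝓑' : ℕ → Submodule S' B') [GradedAlgebra 𝓑']
    (φ : B →+* B') (h : ∀ k, ∀ b ∈ 𝓑 k, φ b ∈ 𝓑' k) : Cga 𝓑 →+* Cga 𝓑' where
  toFun f := ⟨PowerSeries.map φ f.1, fun k => by
    rw [PowerSeries.coeff_map]
    exact h k _ (f.2 k)⟩
  map_one' := Subtype.ext (map_one (PowerSeries.map φ))
  map_mul' f g := Subtype.ext (map_mul (PowerSeries.map φ) f.1 g.1)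
  map_zero' := Subtype.ext (map_zero (PowerSeries.map φ))
  map_add' f g := Subtype.ext (map_add (PowerSeries.map φ) f.1 g.1)

end Cga

/-- An iterable higher derivation `θ : S → Cga 𝓑`, together with its (unique) extension
`ext` to a continuous endomorphism of `Cga 𝓑` which satisfies the iteration rule. -/
structure IterableHD (𝓑 : ℕ → Submodule S B) [GradedAlgebra 𝓑] where
  /-- the higher derivation `θ = ∑ θ⁽ᵏ⁾` -/
  θ : S →+* Cga 𝓑
  /-- `θ⁽⁰⁾` is the identity of `S = 𝓑 0` -/
  θ_zero : ∀ s, (Cga.pr 𝓑 0 (θ s) : B) = algebraMap S B s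
  /-- the homogeneous components are generated by the elements `θ⁽ᵏ⁾ s` (as an algebra: every
  element of every `𝓑 k` is an `S`-linear combination of products of such elements) -/
  generated : Algebra.adjoin S {b : B | ∃ k s, b = Cga.pr 𝓑 k (θ s)} = ⊤
  /-- the extension of `θ` to `Cga 𝓑` -/
  ext : Cga 𝓑 →+* Cga 𝓑
  ext_positive : Cga.IsPositive ext
  ext_algebraMap : ∀ s, ext (algebraMap S (Cga 𝓑) s) = θ s
  /-- the iteration rule `ext⁽ⁱ⁾ ∘ ext⁽ʲ⁾ = (i + j choose i) ext⁽ⁱ⁺ʲ⁾` -/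
  iteration : ∀ (i j k : ℕ) (b : 𝓑 k),
    (Cga.homComp ext i (j + k) (Cga.homComp ext j k b) : B) =
      (i + j).choose i • (Cga.homComp ext (i + j) k b : B)

end Cga

section Theta

variable {F A : Type u} [Field F] [CommRing A] [Algebra F A]

/-- The homogeneous components `S ⊗ 𝒜 k` of the graded `S`-algebra `S ⊗ A`. Its completion
`Cga (gr S 𝒜)` is the tensor product `S ⊗ Cga 𝒜` of completions of graded algebras. -/
abbrev gr (S : Type u) [CommRing S] [Algebra F S] (𝒜 : ℕ → Submodule F A) :
    ℕ → Submodule S (S ⊗[F] A) :=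
  fun k => (𝒜 k).baseChange S

/-- The canonical map `Cga 𝒜 → S ⊗ Cga 𝒜`. -/
def inclRight (S : Type u) [CommRing S] [Algebra F S] (𝒜 : ℕ → Submodule F A) [GradedAlgebra 𝒜] :
    Cga 𝒜 →+* Cga (gr S 𝒜) :=
  Cga.map 𝒜 (gr S 𝒜) (Algebra.TensorProduct.includeRight : A →ₐ[F] S ⊗[F] A).toRingHom
    fun _ _ hb => Submodule.tmul_mem_baseChange_of_mem _ hb

/-- The map `f ⊗ id : S ⊗ Cga 𝒜 → S' ⊗ Cga 𝒜` induced by a homomorphism `f : S → S'` of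
`F`-algebras. -/
def mapLeft {S S' : Type u} [CommRing S] [Algebra F S] [CommRing S'] [Algebra F S']
    (𝒜 : ℕ → Submodule F A) [GradedAlgebra 𝒜] (f : S →ₐ[F] S') :
    Cga (gr S 𝒜) →+* Cga (gr S' 𝒜) :=
  Cga.map (gr S 𝒜) (gr S' 𝒜) (Algebra.TensorProduct.map f (AlgHom.id F A)).toRingHom
    fun k b hb => by
      obtain ⟨x, rfl⟩ := Submodule.toBaseChange_surjective' _ _ hb
      induction x with
      | zero => simp
      | add x y hx hy =>
        simp only [map_add, Submodule.coe_add]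
        exact Submodule.add_mem _ (hx (Subtype.prop _)) (hy (Subtype.prop _))
      | tmul s a =>
        simpa using Submodule.tmul_mem_baseChange_of_mem (f s) a.2

lemma mapLeft_algebraMap {S S' : Type u} [CommRing S] [Algebra F S] [CommRing S'] [Algebra F S']
    (𝒜 : ℕ → Submodule F A) [GradedAlgebra 𝒜] (f : S →ₐ[F] S') (s : S) :
    mapLeft 𝒜 f (algebraMap S (Cga (gr S 𝒜)) s) = algebraMap S' (Cga (gr S' 𝒜)) (f s) := by
  refine Subtype.ext (PowerSeries.ext fun k => ?_)
  change PowerSeries.coeff k (PowerSeries.map _ (algebraMap S (S ⊗[F] A)⟦X⟧ s)) =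
    PowerSeries.coeff k (algebraMap S' (S' ⊗[F] A)⟦X⟧ (f s))
  rw [PowerSeries.coeff_map, PowerSeries.algebraMap_apply, PowerSeries.algebraMap_apply,
    PowerSeries.coeff_C, PowerSeries.coeff_C]
  split_ifs
  · simp [Algebra.TensorProduct.algebraMap_apply]
  · simp

lemma mapLeft_comp {S S' S'' : Type u} [CommRing S] [Algebra F S] [CommRing S'] [Algebra F S']
    [CommRing S''] [Algebra F S''] (𝒜 : ℕ → Submodule F A) [GradedAlgebra 𝒜]
    (g : S' →ₐ[F] S'') (f : S →ₐ[F] S') (x : Cga (gr S 𝒜)) :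
    mapLeft 𝒜 (g.comp f) x = mapLeft 𝒜 g (mapLeft 𝒜 f x) := by
  refine Subtype.ext (PowerSeries.ext fun k => ?_)
  change PowerSeries.coeff k (PowerSeries.map _ x.1) =
    PowerSeries.coeff k (PowerSeries.map _ (PowerSeries.map _ x.1))
  simp only [PowerSeries.coeff_map]
  generalize PowerSeries.coeff k x.1 = y
  induction y with
  | zero => simp
  | add a b ha hb => rw [map_add, ha, hb, map_add, map_add]
  | tmul s a => simp

lemma mapLeft_id {S : Type u} [CommRing S] [Algebra F S] (𝒜 : ℕ → Submodule F A)
    [GradedAlgebra 𝒜] (x : Cga (gr S 𝒜)) : mapLeft 𝒜 (AlgHom.id F S) x = x := by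
  refine Subtype.ext (PowerSeries.ext fun k => ?_)
  change PowerSeries.coeff k (PowerSeries.map _ x.1) = PowerSeries.coeff k x.1
  simp

/-- The base data: a field `F` containing `K`, a completion `Cga 𝒜` of a graded `F`-algebra with
`𝒜 0 = F` and without zero divisors, and an iterable higher derivation `θ : F → Cga 𝒜` whose
constants are exactly the elements of `K`. -/
structure ThetaBase (K : Type u) [Field K] [Algebra K F] (𝒜 : ℕ → Submodule F A)
    [GradedAlgebra 𝒜] extends IterableHD 𝒜 where
  algebraMap_injective : Function.Injective (algebraMap F A)
  deg_zero : ∀ a ∈ 𝒜 0, ∃ f : F, algebraMap F A f = a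
  isDomain : IsDomain (Cga 𝒜)
  constants : ∀ t : F, θ t = algebraMap F (Cga 𝒜) t ↔ ∃ c : K, algebraMap K F c = t

variable {K : Type u} [Field K] [Algebra K F] {𝒜 : ℕ → Submodule F A} [GradedAlgebra 𝒜]

/-- A `θ`-ring structure on an `F`-algebra `R`: an iterable higher derivation
`θ_R : R → R ⊗ Cga 𝒜` extending `θ`. -/
structure ThetaRing (Θ : ThetaBase K 𝒜) (R : Type u) [CommRing R] [Algebra F R]
    extends IterableHD (gr R 𝒜) where
  extends_base : ∀ f : F, θ (algebraMap F R f) = inclRight R 𝒜 (Θ.θ f)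

namespace ThetaRing

variable {Θ : ThetaBase K 𝒜} {R : Type u} [CommRing R] [Algebra F R] (T : ThetaRing Θ R)

/-- `r` is a constant: `θ_R r = r ⊗ 1`. -/
def IsConstant (r : R) : Prop := T.θ r = algebraMap R (Cga (gr R 𝒜)) r

/-- `I` is a `θ`-ideal: `θ_R⁽ᵏ⁾ I ⊆ I ⊗ 𝒜 k` for all `k`. -/
def IsThetaIdeal (I : Ideal R) : Prop :=
  ∀ (k : ℕ), ∀ r ∈ I, (Cga.pr (gr R 𝒜) k (T.θ r) : R ⊗[F] A) ∈
    LinearMap.range (TensorProduct.map (I.restrictScalars F).subtype (𝒜 k).subtype)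

/-- `R` is `θ`-simple: it is nonzero, and `0` and `R` are its only `θ`-ideals. -/
def IsThetaSimple : Prop :=
  Nontrivial R ∧ ∀ I : Ideal R, T.IsThetaIdeal I → I = ⊥ ∨ I = ⊤

end ThetaRing

/-- An iterable higher differential equation `θ(y) = A y` over `F`: a matrix
`A = ∑ Aₖ ∈ GLₙ(Cga 𝒜)` with `A₀ = 1` and
`(k + l choose l) A_{k+l} = ∑_{i+j=l} θ⁽ⁱ⁾(Aₖ) Aⱼ`. -/
structure IterableEquation (Θ : ThetaBase K 𝒜) (n : ℕ) where
  mat : GL (Fin n) (Cga 𝒜)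
  mat_zero : ∀ p q, (Cga.pr 𝒜 0 (mat p q) : A) = (1 : Matrix (Fin n) (Fin n) A) p q
  iteration : ∀ (k l : ℕ) (p q : Fin n),
    (k + l).choose l • (Cga.pr 𝒜 (k + l) (mat p q) : A) =
      ∑ ij ∈ Finset.HasAntidiagonal.antidiagonal l, ∑ m,
        (Cga.homComp Θ.ext ij.1 k (Cga.pr 𝒜 k (mat p m)) : A) * Cga.pr 𝒜 ij.2 (mat m q)

/-- `Y ∈ GLₙ(R)` is a fundamental solution matrix: `θ_R(Y) = A Y`. -/
def IsFundamentalMatrix {Θ : ThetaBase K 𝒜} {R : Type u} [CommRing R] [Algebra F R]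
    (T : ThetaRing Θ R) {n : ℕ} (M : IterableEquation Θ n) (Y : GL (Fin n) R) : Prop :=
  ∀ p q, T.θ (Y p q) =
    ∑ m, inclRight R 𝒜 (M.mat p m) * algebraMap R (Cga (gr R 𝒜)) (Y m q)

/-- `R` is a pseudo Picard-Vessiot ring for the equation `θ(y) = A y`. -/
structure IsPPVRing {Θ : ThetaBase K 𝒜} {R : Type u} [CommRing R] [Algebra F R]
    (T : ThetaRing Θ R) {n : ℕ} (M : IterableEquation Θ n) : Prop where
  simple : T.IsThetaSimple
  exists_fundamental : ∃ Y : GL (Fin n) R, IsFundamentalMatrix T M Y ∧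
    Algebra.adjoin F ({r | ∃ p q, r = Y p q} ∪
      {(((Matrix.GeneralLinearGroup.det Y)⁻¹ : Rˣ) : R)}) = ⊤
  constants : ∀ r : R, T.IsConstant r ↔ ∃ c : K, algebraMap F R (algebraMap K F c) = r

section Galois

variable {Θ : ThetaBase K 𝒜} {R : Type u} [CommRing R] [Algebra K R] [Algebra F R]
  [IsScalarTower K F R] (T : ThetaRing Θ R)

lemma ThetaRing.θ_algebraMap (c : K) :
    T.θ (algebraMap K R c) = algebraMap R (Cga (gr R 𝒜)) (algebraMap K R c) := by
  rw [IsScalarTower.algebraMap_apply K F R, T.extends_base, (Θ.constants _).2 ⟨c, rfl⟩]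
  refine Subtype.ext (PowerSeries.ext fun k => ?_)
  change PowerSeries.coeff k (PowerSeries.map _ (algebraMap F A⟦X⟧ (algebraMap K F c))) =
    PowerSeries.coeff k (algebraMap R (R ⊗[F] A)⟦X⟧ _)
  rw [PowerSeries.coeff_map, PowerSeries.algebraMap_apply, PowerSeries.algebraMap_apply,
    PowerSeries.coeff_C, PowerSeries.coeff_C]
  split_ifs
  · simp [Algebra.TensorProduct.algebraMap_apply]
  · simp

/-- The trivial extension `θ_R ⊗ id` of `θ_R` to `R ⊗ L`, for a `K`-algebra `L`. It is the
ring homomorphism with `r ⊗ a ↦ θ_R(r) ⊗ a`. -/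
def ThetaRing.trivialExt (L : Type u) [CommRing L] [Algebra K L] :
    R ⊗[K] L →+* Cga (gr (R ⊗[K] L) 𝒜) :=
  letI : Algebra K (Cga (gr (R ⊗[K] L) 𝒜)) :=
    ((algebraMap (R ⊗[K] L) (Cga (gr (R ⊗[K] L) 𝒜))).comp (algebraMap K (R ⊗[K] L))).toAlgebra
  (Algebra.TensorProduct.lift
    (({ ((mapLeft 𝒜 (Algebra.TensorProduct.includeLeft : R →ₐ[F] R ⊗[K] L)).comp T.θ) with
        commutes' := fun c => by
          change mapLeft 𝒜 _ (T.θ (algebraMap K R c)) = algebraMap (R ⊗[K] L) _ _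
          rw [T.θ_algebraMap, mapLeft_algebraMap]
          rfl } : R →ₐ[K] Cga (gr (R ⊗[K] L) 𝒜)))
    (({ ((algebraMap (R ⊗[K] L) (Cga (gr (R ⊗[K] L) 𝒜))).comp
          (Algebra.TensorProduct.includeRight : L →ₐ[K] R ⊗[K] L).toRingHom) with
        commutes' := fun c => by
          change algebraMap (R ⊗[K] L) _ (1 ⊗ₜ algebraMap K L c) = algebraMap (R ⊗[K] L) _ _
          rw [← Algebra.TensorProduct.tmul_one_eq_one_tmul]
          rfl } : L →ₐ[K] Cga (gr (R ⊗[K] L) 𝒜)))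
    fun _ _ => Commute.all _ _ : R ⊗[K] L →ₐ[K] Cga (gr (R ⊗[K] L) 𝒜)).toRingHom

lemma ThetaRing.trivialExt_left (L : Type u) [CommRing L] [Algebra K L] (r : R) :
    T.trivialExt L (r ⊗ₜ 1) =
      mapLeft 𝒜 (Algebra.TensorProduct.includeLeft : R →ₐ[F] R ⊗[K] L) (T.θ r) := by
  let _ : Algebra K (Cga (gr (R ⊗[K] L) 𝒜)) :=
    ((algebraMap (R ⊗[K] L) (Cga (gr (R ⊗[K] L) 𝒜))).comp (algebraMap K (R ⊗[K] L))).toAlgebra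
  refine (Algebra.TensorProduct.lift_tmul _ _ _ r (1 : L)).trans ?_
  rw [map_one, mul_one]
  rfl

lemma ThetaRing.trivialExt_right (L : Type u) [CommRing L] [Algebra K L] (a : L) :
    T.trivialExt L (1 ⊗ₜ a) = algebraMap (R ⊗[K] L) (Cga (gr (R ⊗[K] L) 𝒜)) (1 ⊗ₜ a) := by
  let _ : Algebra K (Cga (gr (R ⊗[K] L) 𝒜)) :=
    ((algebraMap (R ⊗[K] L) (Cga (gr (R ⊗[K] L) 𝒜))).comp (algebraMap K (R ⊗[K] L))).toAlgebra
  refine (Algebra.TensorProduct.lift_tmul _ _ _ (1 : R) a).trans ?_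
  rw [map_one, one_mul]
  rfl

/-- The group `Aut^θ(R ⊗ L / F ⊗ L)`: the automorphisms of the ring `R ⊗ L` that are `F`-linear and
fix `1 ⊗ L` (that is, are `F ⊗ L`-linear), and that commute with the higher derivation of
`R ⊗ L`. -/
def thetaAut (L : Type u) [CommRing L] [Algebra K L] :
    Subgroup ((R ⊗[K] L) ≃ₐ[F] (R ⊗[K] L)) where
  carrier := {σ | (∀ a : L, σ (1 ⊗ₜ a) = 1 ⊗ₜ a) ∧
    ∀ x, T.trivialExt L (σ x) = mapLeft 𝒜 (σ : (R ⊗[K] L) →ₐ[F] (R ⊗[K] L)) (T.trivialExt L x)}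
  one_mem' := ⟨fun _ => rfl, fun x => (mapLeft_id 𝒜 _).symm⟩
  mul_mem' {σ τ} hσ hτ := by
    refine ⟨fun a => ?_, fun x => ?_⟩
    · rw [AlgEquiv.mul_apply, hτ.1, hσ.1]
    · rw [AlgEquiv.mul_apply, hσ.2, hτ.2, ← mapLeft_comp]
      rfl
  inv_mem' {σ} hσ := by
    refine ⟨fun a => ?_, fun x => ?_⟩
    · change σ.symm _ = _
      rw [AlgEquiv.symm_apply_eq, hσ.1]
    · change T.trivialExt L (σ.symm x) = mapLeft 𝒜 (σ.symm : (R ⊗[K] L) →ₐ[F] (R ⊗[K] L)) _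
      have h := hσ.2 (σ.symm x)
      rw [AlgEquiv.apply_symm_apply] at h
      rw [h, ← mapLeft_comp]
      have e : (σ.symm : (R ⊗[K] L) →ₐ[F] (R ⊗[K] L)).comp
          (σ : (R ⊗[K] L) →ₐ[F] (R ⊗[K] L)) = AlgHom.id F _ := by
        exact AlgHom.ext fun y => σ.symm_apply_apply y
      rw [e, mapLeft_id]

/-- For `φ : L → L'`, the `F ⊗ L'`-linear endomorphism of `R ⊗ L' = (R ⊗ L) ⊗_L L'` obtained
from an endomorphism `σ` of `R ⊗ L` by base change: `r ⊗ a ↦ (id ⊗ φ)(σ(r ⊗ 1)) (1 ⊗ a)`. -/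
def baseChangeHom {L L' : Type u} [CommRing L] [Algebra K L] [CommRing L'] [Algebra K L']
    (φ : L →ₐ[K] L') (σ : (R ⊗[K] L) →ₐ[F] (R ⊗[K] L)) : (R ⊗[K] L') →ₐ[F] (R ⊗[K] L') :=
  Algebra.TensorProduct.lift
    (((Algebra.TensorProduct.map (AlgHom.id F R) φ).comp σ).comp
      (Algebra.TensorProduct.includeLeft : R →ₐ[F] R ⊗[K] L))
    (Algebra.TensorProduct.includeRight : L' →ₐ[K] R ⊗[K] L')
    fun _ _ => Commute.all _ _

lemma baseChangeHom_tmul {L L' : Type u} [CommRing L] [Algebra K L] [CommRing L'] [Algebra K L']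
    (φ : L →ₐ[K] L') (σ : (R ⊗[K] L) →ₐ[F] (R ⊗[K] L)) (r : R) (a : L') :
    baseChangeHom φ σ (r ⊗ₜ a) =
      Algebra.TensorProduct.map (AlgHom.id F R) φ (σ (r ⊗ₜ 1)) * (1 ⊗ₜ a) := by
  simp [baseChangeHom]

lemma baseChangeHom_map {L L' : Type u} [CommRing L] [Algebra K L] [CommRing L'] [Algebra K L']
    (φ : L →ₐ[K] L') (σ : (R ⊗[K] L) →ₐ[F] (R ⊗[K] L)) (hσ : ∀ a : L, σ (1 ⊗ₜ a) = 1 ⊗ₜ a)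
    (x : R ⊗[K] L) :
    baseChangeHom φ σ (Algebra.TensorProduct.map (AlgHom.id F R) φ x) =
      Algebra.TensorProduct.map (AlgHom.id F R) φ (σ x) := by
  induction x with
  | zero => simp
  | add x y hx hy => simp only [map_add, hx, hy]
  | tmul r a =>
    have h : (r ⊗ₜ[K] a : R ⊗[K] L) = (r ⊗ₜ 1) * (1 ⊗ₜ a) := by simp
    rw [Algebra.TensorProduct.map_tmul, baseChangeHom_tmul, h, map_mul σ, hσ, map_mul]
    simp

lemma baseChangeHom_one {L L' : Type u} [CommRing L] [Algebra K L] [CommRing L'] [Algebra K L']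
    (φ : L →ₐ[K] L') :
    baseChangeHom φ (AlgHom.id F (R ⊗[K] L)) = AlgHom.id F (R ⊗[K] L') := by
  refine AlgHom.ext fun x => ?_
  induction x with
  | zero => simp
  | add x y hx hy => rw [map_add, hx, hy, map_add]
  | tmul r a => simp [baseChangeHom_tmul]

lemma baseChangeHom_mul {L L' : Type u} [CommRing L] [Algebra K L] [CommRing L'] [Algebra K L']
    (φ : L →ₐ[K] L') (σ τ : (R ⊗[K] L) →ₐ[F] (R ⊗[K] L))
    (hσ : ∀ a : L, σ (1 ⊗ₜ a) = 1 ⊗ₜ a) :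
    baseChangeHom φ (σ.comp τ) = (baseChangeHom φ σ).comp (baseChangeHom φ τ) := by
  refine AlgHom.ext fun x => ?_
  induction x with
  | zero => simp
  | add x y hx hy => rw [map_add, hx, hy, map_add]
  | tmul r a =>
    rw [AlgHom.comp_apply, baseChangeHom_tmul, baseChangeHom_tmul, map_mul,
      baseChangeHom_map φ σ hσ, baseChangeHom_tmul]
    have h1 : (1 : R ⊗[K] L) = 1 ⊗ₜ 1 := rfl
    rw [← h1, map_one, map_one, one_mul]
    rfl

lemma ThetaRing.trivialExt_map {L L' : Type u} [CommRing L] [Algebra K L] [CommRing L']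
    [Algebra K L'] (φ : L →ₐ[K] L') (x : R ⊗[K] L) :
    T.trivialExt L' (Algebra.TensorProduct.map (AlgHom.id F R) φ x) =
      mapLeft 𝒜 (Algebra.TensorProduct.map (AlgHom.id F R) φ) (T.trivialExt L x) := by
  induction x with
  | zero => simp only [map_zero]
  | add x y hx hy => simp only [map_add, hx, hy]
  | tmul r a =>
    have h : (r ⊗ₜ[K] a : R ⊗[K] L) = (r ⊗ₜ 1) * (1 ⊗ₜ a) := by simp
    rw [h]
    simp only [map_mul]
    congr 1
    · rw [T.trivialExt_left, ← mapLeft_comp, Algebra.TensorProduct.map_tmul, map_one,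
        AlgHom.id_apply, T.trivialExt_left]
      congr 2
      refine AlgHom.ext fun y => ?_
      simp
    · rw [T.trivialExt_right, mapLeft_algebraMap, Algebra.TensorProduct.map_tmul, map_one,
        T.trivialExt_right]

lemma ThetaRing.trivialExt_baseChangeHom {L L' : Type u} [CommRing L] [Algebra K L] [CommRing L']
    [Algebra K L'] (φ : L →ₐ[K] L') (σ : (R ⊗[K] L) →ₐ[F] (R ⊗[K] L))
    (hσ : ∀ a : L, σ (1 ⊗ₜ a) = 1 ⊗ₜ a)
    (h : ∀ x, T.trivialExt L (σ x) = mapLeft 𝒜 σ (T.trivialExt L x)) (x : R ⊗[K] L') :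
    T.trivialExt L' (baseChangeHom φ σ x) =
      mapLeft 𝒜 (baseChangeHom φ σ) (T.trivialExt L' x) := by
  induction x with
  | zero => simp only [map_zero]
  | add x y hx hy => simp only [map_add, hx, hy]
  | tmul r a =>
    have e : (r ⊗ₜ[K] a : R ⊗[K] L') = (r ⊗ₜ 1) * (1 ⊗ₜ a) := by simp
    rw [e]
    simp only [map_mul]
    congr 1
    · have e1 : (r ⊗ₜ[K] 1 : R ⊗[K] L') =
          Algebra.TensorProduct.map (AlgHom.id F R) φ (r ⊗ₜ 1) := by simp
      have e2 : (baseChangeHom φ σ).comp (Algebra.TensorProduct.map (AlgHom.id F R) φ) =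
          (Algebra.TensorProduct.map (AlgHom.id F R) φ).comp σ :=
        AlgHom.ext fun y => baseChangeHom_map φ σ hσ y
      rw [e1, baseChangeHom_map φ σ hσ, T.trivialExt_map, T.trivialExt_map, h, ← mapLeft_comp,
        ← mapLeft_comp, e2]
    · have e1 : baseChangeHom φ σ (1 ⊗ₜ a) = 1 ⊗ₜ a := by
        rw [baseChangeHom_tmul, hσ]
        simp
      rw [e1, T.trivialExt_right, mapLeft_algebraMap, e1]

/-- Base change of automorphisms along `φ : L → L'`. -/
def baseChangeEquiv {L L' : Type u} [CommRing L] [Algebra K L] [CommRing L'] [Algebra K L']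
    (φ : L →ₐ[K] L') (σ : thetaAut T L) : (R ⊗[K] L') ≃ₐ[F] (R ⊗[K] L') :=
  AlgEquiv.ofAlgHom (baseChangeHom φ (σ.1 : (R ⊗[K] L) →ₐ[F] (R ⊗[K] L)))
    (baseChangeHom φ ((σ⁻¹).1 : (R ⊗[K] L) →ₐ[F] (R ⊗[K] L)))
    (by
      rw [← baseChangeHom_mul φ _ _ σ.2.1, ← baseChangeHom_one φ]
      exact congrArg _ (AlgHom.ext fun x => σ.1.apply_symm_apply x))
    (by
      rw [← baseChangeHom_mul φ _ _ (σ⁻¹).2.1, ← baseChangeHom_one φ]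
      exact congrArg _ (AlgHom.ext fun x => σ.1.symm_apply_apply x))

lemma baseChangeEquiv_apply {L L' : Type u} [CommRing L] [Algebra K L] [CommRing L']
    [Algebra K L'] (φ : L →ₐ[K] L') (σ : thetaAut T L) (x : R ⊗[K] L') :
    baseChangeEquiv T φ σ x = baseChangeHom φ (σ.1 : (R ⊗[K] L) →ₐ[F] (R ⊗[K] L)) x := rfl

lemma baseChangeEquiv_mem {L L' : Type u} [CommRing L] [Algebra K L] [CommRing L']
    [Algebra K L'] (φ : L →ₐ[K] L') (σ : thetaAut T L) :
    baseChangeEquiv T φ σ ∈ thetaAut T L' := by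
  refine ⟨fun a => ?_, fun x => ?_⟩
  · have h := σ.2.1 1
    rw [baseChangeEquiv_apply, baseChangeHom_tmul]
    simp only [AlgEquiv.coe_toAlgHom]
    rw [h]
    simp
  · exact T.trivialExt_baseChangeHom φ _ σ.2.1 σ.2.2 x

/-- Base change `Aut^θ(R ⊗ L / F ⊗ L) → Aut^θ(R ⊗ L' / F ⊗ L')` along `φ : L → L'`. -/
def thetaAutMap {L L' : Type u} [CommRing L] [Algebra K L] [CommRing L'] [Algebra K L']
    (φ : L →ₐ[K] L') : thetaAut T L →* thetaAut T L' where
  toFun σ := ⟨baseChangeEquiv T φ σ, baseChangeEquiv_mem T φ σ⟩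
  map_one' := Subtype.ext (AlgEquiv.ext fun x => DFunLike.congr_fun (baseChangeHom_one φ) x)
  map_mul' σ τ := Subtype.ext (AlgEquiv.ext fun x =>
    DFunLike.congr_fun (baseChangeHom_mul φ (σ.1 : (R ⊗[K] L) →ₐ[F] (R ⊗[K] L))
      (τ.1 : (R ⊗[K] L) →ₐ[F] (R ⊗[K] L)) σ.2.1) x)

lemma thetaAutMap_id (L : Type u) [CommRing L] [Algebra K L] (σ : thetaAut T L) :
    thetaAutMap T (AlgHom.id K L) σ = σ := by
  refine Subtype.ext (AlgEquiv.ext fun x => ?_)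
  change baseChangeHom (AlgHom.id K L) (σ.1 : (R ⊗[K] L) →ₐ[F] (R ⊗[K] L)) x = σ.1 x
  have h := baseChangeHom_map (AlgHom.id K L) (σ.1 : (R ⊗[K] L) →ₐ[F] (R ⊗[K] L)) σ.2.1 x
  have e (y : R ⊗[K] L) :
      Algebra.TensorProduct.map (AlgHom.id F R) (AlgHom.id K L) y = y := by
    induction y with
    | zero => simp
    | add a b ha hb => rw [map_add, ha, hb]
    | tmul r a => simp
  rw [e, e] at h
  exact h

lemma thetaAutMap_comp {L L' L'' : Type u} [CommRing L] [Algebra K L] [CommRing L']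
    [Algebra K L'] [CommRing L''] [Algebra K L''] (ψ : L' →ₐ[K] L'') (φ : L →ₐ[K] L')
    (σ : thetaAut T L) :
    thetaAutMap T (ψ.comp φ) σ = thetaAutMap T ψ (thetaAutMap T φ σ) := by
  refine Subtype.ext (AlgEquiv.ext fun x => ?_)
  change baseChangeHom (ψ.comp φ) (σ.1 : (R ⊗[K] L) →ₐ[F] (R ⊗[K] L)) x =
    baseChangeHom ψ (baseChangeHom φ (σ.1 : (R ⊗[K] L) →ₐ[F] (R ⊗[K] L))) x
  induction x with
  | zero => simp only [map_zero]
  | add a b ha hb => simp only [map_add, ha, hb]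
  | tmul r a =>
    rw [baseChangeHom_tmul, baseChangeHom_tmul, baseChangeHom_tmul]
    congr 1
    generalize (σ.1 : (R ⊗[K] L) →ₐ[F] (R ⊗[K] L)) (r ⊗ₜ 1) = y
    rw [show (1 ⊗ₜ[K] (1 : L') : R ⊗[K] L') = 1 from rfl, mul_one]
    induction y with
    | zero => simp only [map_zero]
    | add a b ha hb => simp only [map_add, ha, hb]
    | tmul r a => simp

open CategoryTheory in
/-- The Galois group scheme `Gal(R/F)` as a group functor on `K`-algebras,
`L ↦ Aut^θ(R ⊗ L / F ⊗ L)`. -/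
def galoisGroup : CommAlgCat.{u} K ⥤ GrpCat.{u} where
  obj L := GrpCat.of (thetaAut T L)
  map φ := GrpCat.ofHom (thetaAutMap T φ.hom)
  map_id L := GrpCat.hom_ext (MonoidHom.ext fun σ => thetaAutMap_id T L σ)
  map_comp φ ψ := GrpCat.hom_ext (MonoidHom.ext fun σ => thetaAutMap_comp T ψ.hom φ.hom σ)

end Galois

end Theta

section Infinitesimal

open CategoryTheory

variable {K : Type u} [Field K]

/-- The augmentation (the counit, that is, evaluation at the neutral element) `H → K` of an algebra
`H` representing a group functor `G`: the homomorphism that corresponds to the neutral element of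
the group `G(K)`. -/
def augmentation {G : CommAlgCat.{u} K ⥤ GrpCat.{u}} {H : CommAlgCat.{u} K}
    (e : (G ⋙ forget GrpCat.{u}).CorepresentableBy H) : H →ₐ[K] K :=
  (e.homEquiv.symm (1 : G.obj (CommAlgCat.of K K))).hom

/-- The group functor `G` is an infinitesimal group scheme over `K`: it is an affine group scheme
(that is, represented by a `K`-algebra `H`) which is finite over `K` and whose augmentation ideal,
the ideal of the neutral element, is nilpotent. -/
def IsInfinitesimal (G : CommAlgCat.{u} K ⥤ GrpCat.{u}) : Prop :=
  ∃ (H : CommAlgCat.{u} K) (e : (G ⋙ forget GrpCat.{u}).CorepresentableBy H),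
    Module.Finite K H ∧ IsNilpotent (RingHom.ker (augmentation e))

end Infinitesimal

end PPV

end

/-! Everything happens in the tensor square `R ⊗[F] R`. Let `C` be its ring of constants for the
higher derivation `θ ⊗ θ`. The torsor property says that `R ⊗[K] C → R ⊗[F] R` is an isomorphism. It
is injective because constants that are linearly independent over `K` stay so over the `θ`-simple
ring `R` (`linearIndependent_of_constants`). It is surjective because the entries of `(Y ⊗ 1)⁻¹ (1 ⊗
Y)` are constants (`ThetaRing.toSquare_surjective`).

Consequently `C` represents the Galois group scheme: an automorphism `σ` of `R ⊗ L` corresponds to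
the restriction of `r ⊗ s ↦ r σ(s)` to `C`, which lands in the constants `L` of `R ⊗ L`
(`thetaAutMap_universal_bijective`). The neutral element gives `r ⊗ s ↦ r s`, so the augmentation of
`C` is the restriction of the multiplication `R ⊗[F] R → R` (`algebraMap_augmentation`).

Now `E` is purely inseparable over `F` if and only if the kernel of this multiplication is nil
(`ker_lmul'_le_nilradical` and `isPurelyInseparable_of_ker_lmul'_le_nilradical`), and by the
isomorphism the kernel is nil exactly when the augmentation ideal of `C` is nil. If `E` is purely
inseparable over `F`, then `R` is finite over `F`, so `C` is finite over `K`, and nil becomes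
nilpotent. -/

noncomputable section

namespace PPV

/-! ### Contraction of tensors along linear forms -/

section Contraction

variable {F A : Type u} [Field F] [CommRing A] [Algebra F A]

/-- The contraction `id ⊗ l : S ⊗ A → S` along a linear form `l` on `A`. -/
def contract (S : Type u) [CommRing S] [Algebra F S] (l : A →ₗ[F] F) : S ⊗[F] A →ₗ[S] S :=
  (TensorProduct.AlgebraTensorModule.rid F S S).toLinearMap ∘ₗ l.baseChange S

@[simp]
lemma contract_tmul {S : Type u} [CommRing S] [Algebra F S] (l : A →ₗ[F] F) (s : S) (a : A) :
    contract S l (s ⊗ₜ a) = l a • s := by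
  simp [contract]

lemma contract_map {S S' : Type u} [CommRing S] [Algebra F S] [CommRing S'] [Algebra F S']
    (l : A →ₗ[F] F) (f : S →ₐ[F] S') (x : S ⊗[F] A) :
    contract S' l (Algebra.TensorProduct.map f (AlgHom.id F A) x) = f (contract S l x) := by
  induction x with
  | zero => simp
  | add x y hx hy => simp only [map_add, hx, hy]
  | tmul s a => simp

/-- An element of `S ⊗ V` whose contractions all lie in an ideal `I` lies in `I ⊗ V`. -/
lemma mem_range_of_contract_mem {S : Type u} [CommRing S] [Algebra F S] (V : Submodule F A)
    (I : Ideal S) (x : S ⊗[F] A) (hx : x ∈ V.baseChange S)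
    (h : ∀ l : A →ₗ[F] F, contract S l x ∈ I) :
    x ∈ LinearMap.range (TensorProduct.map (I.restrictScalars F).subtype V.subtype) := by
  obtain ⟨y, rfl⟩ : x ∈ LinearMap.range (V.subtype.baseChange S) := hx
  let b := Module.Basis.ofVectorSpace F V
  let B := b.baseChange S
  have key (i) : B.repr y i ∈ I := by
    -- Over a field the coordinate form on `V` extends to `A`; contracting along the extension reads
    -- off the `i`-th coordinate.
    obtain ⟨l, hl⟩ := (b.coord i).exists_extend
    have e : contract S l (V.subtype.baseChange S y) = B.repr y i := by
      clear h
      induction y with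
      | zero => simp
      | add y z hy hz => simp only [map_add, Finsupp.add_apply, hy, hz]
      | tmul s v =>
        rw [LinearMap.baseChange_tmul, contract_tmul, Module.Basis.baseChange_repr_tmul,
          ← Module.Basis.coord_apply, ← hl]
        rfl
    exact e ▸ h l
  rw [← B.linearCombination_repr y, Finsupp.linearCombination_apply, Finsupp.sum, map_sum]
  refine Submodule.sum_mem _ fun i _ => ⟨(⟨B.repr y i, key i⟩ : I.restrictScalars F) ⊗ₜ b i, ?_⟩
  rw [TensorProduct.map_tmul, map_smul, Module.Basis.baseChange_apply, LinearMap.baseChange_tmul,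
    TensorProduct.smul_tmul', smul_eq_mul, mul_one]
  rfl

end Contraction

/-! ### Tensor products of maps that need not be `F`-linear -/

section RingLift

variable {F : Type*} [CommRing F]

/-- The ring homomorphism `R ⊗ R' → S` induced by ring homomorphisms `R → S` and `R' → S` which
agree on `F`. -/
def ringLift {R R' S : Type*} [CommRing R] [Algebra F R] [CommRing R'] [Algebra F R'] [CommRing S]
    (f : R →+* S) (g : R' →+* S)
    (h : f.comp (algebraMap F R) = g.comp (algebraMap F R')) : R ⊗[F] R' →+* S :=
  -- Higher derivations are not linear over `F`. Letting `F` act on the target through `f` makes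
  -- both maps linear.
  letI : Algebra F S := (f.comp (algebraMap F R)).toAlgebra
  (Algebra.TensorProduct.lift ({ f with commutes' := fun _ => rfl } : R →ₐ[F] S)
    ({ g with commutes' := fun c => (DFunLike.congr_fun h c).symm } : R' →ₐ[F] S)
    fun _ _ => Commute.all _ _).toRingHom

@[simp]
lemma ringLift_tmul {R R' S : Type*} [CommRing R] [Algebra F R] [CommRing R'] [Algebra F R']
    [CommRing S] (f : R →+* S) (g : R' →+* S)
    (h : f.comp (algebraMap F R) = g.comp (algebraMap F R')) (r : R) (r' : R') :
    ringLift f g h (r ⊗ₜ r') = f r * g r' := by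
  let _ : Algebra F S := (f.comp (algebraMap F R)).toAlgebra
  exact Algebra.TensorProduct.lift_tmul _ _ _ r r'

end RingLift

/-! ### Linear disjointness of constants from a `θ`-simple ring -/

section LinearDisjoint

variable {F A : Type u} [Field F] [CommRing A] [Algebra F A] {K : Type u} [Field K] [Algebra K F]
  {𝒜 : ℕ → Submodule F A} [GradedAlgebra 𝒜] {Θ : ThetaBase K 𝒜}
  {R : Type u} [CommRing R] [Algebra F R]

lemma coeff_mapLeft {S S' : Type u} [CommRing S] [Algebra F S] [CommRing S'] [Algebra F S']
    (f : S →ₐ[F] S') (x : Cga (gr S 𝒜)) (k : ℕ) :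
    PowerSeries.coeff k (mapLeft 𝒜 f x).1 =
      Algebra.TensorProduct.map f (AlgHom.id F A) (PowerSeries.coeff k x.1) := by
  change PowerSeries.coeff k (PowerSeries.map _ x.1) = _
  rw [PowerSeries.coeff_map]
  rfl

lemma coeff_algebraMap {S : Type u} [CommRing S] [Algebra F S] (s : S) (k : ℕ) :
    PowerSeries.coeff k (algebraMap S (Cga (gr S 𝒜)) s).1 =
      if k = 0 then s ⊗ₜ[F] (1 : A) else 0 := by
  change PowerSeries.coeff k (algebraMap S (S ⊗[F] A)⟦X⟧ s) = _
  rw [PowerSeries.algebraMap_apply, PowerSeries.coeff_C]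
  rfl

/-- The additive map `(id ⊗ l) ∘ θ⁽ᵏ⁾ : S → S`, for a linear form `l` on `A`. -/
def component {S : Type u} [CommRing S] [Algebra F S] (θ : S →+* Cga (gr S 𝒜)) (k : ℕ)
    (l : A →ₗ[F] F) : S →+ S where
  toFun s := contract S l (PowerSeries.coeff k (θ s).1)
  map_zero' := by simp
  map_add' s t := by simp

lemma component_apply {S : Type u} [CommRing S] [Algebra F S] (θ : S →+* Cga (gr S 𝒜)) (k : ℕ)
    (l : A →ₗ[F] F) (s : S) :
    component θ k l s = contract S l (PowerSeries.coeff k (θ s).1) := rfl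

/-- Since `θS c` is concentrated in degree `0`, multiplicativity lets `c` pass through every
component like a scalar. -/
lemma component_smul_of_constant {R S : Type u} [CommRing R] [Algebra F R] [CommRing S]
    [Algebra F S] [Algebra R S] [IsScalarTower F R S]
    {θR : R →+* Cga (gr R 𝒜)} {θS : S →+* Cga (gr S 𝒜)}
    (h : ∀ r, θS (algebraMap R S r) = mapLeft 𝒜 (IsScalarTower.toAlgHom F R S) (θR r))
    {c : S} (hc : θS c = algebraMap S _ c) (k : ℕ) (l : A →ₗ[F] F) (r : R) :
    component θS k l (r • c) = component θR k l r • c := by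
  have e : PowerSeries.coeff k (θS (r • c)).1 =
      c • PowerSeries.coeff k (θS (algebraMap R S r)).1 := by
    rw [Algebra.smul_def, map_mul, hc, mul_comm, ← Algebra.smul_def]
    rfl
  rw [component_apply, e, map_smul, h, coeff_mapLeft, contract_map, smul_eq_mul, mul_comm,
    Algebra.smul_def]
  rfl

/-- This turns a relation between constants into new relations whose supports are no larger,
obtained by applying the components to the coefficients. -/
lemma component_linearCombination {R S : Type u} [CommRing R] [Algebra F R] [CommRing S]
    [Algebra F S] [Algebra R S] [IsScalarTower F R S]
    {θR : R →+* Cga (gr R 𝒜)} {θS : S →+* Cga (gr S 𝒜)}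
    (h : ∀ r, θS (algebraMap R S r) = mapLeft 𝒜 (IsScalarTower.toAlgHom F R S) (θR r))
    {ι : Type*} {c : ι → S} (hc : ∀ i, θS (c i) = algebraMap S _ (c i)) (k : ℕ) (l : A →ₗ[F] F)
    (m : ι →₀ R) :
    component θS k l (Finsupp.linearCombination R c m) =
      Finsupp.linearCombination R c (m.mapRange (component θR k l) (map_zero _)) := by
  induction m using Finsupp.induction_linear with
  | zero => simp
  | add f g hf hg =>
    rw [Finsupp.mapRange_add (map_add _), map_add, map_add, map_add, hf, hg]
  | single i r => simp [component_smul_of_constant h (hc i)]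

/-- The ideal of values at `i` of those `R`-linear relations between constants `c` which are
supported on `s`. -/
def relationIdeal {R S : Type u} [CommRing R] [CommRing S] [Algebra R S] {ι : Type*} (c : ι → S)
    (s : Set ι) (i : ι) : Ideal R :=
  (LinearMap.ker (Finsupp.linearCombination R c) ⊓ Finsupp.supported R R s).map (Finsupp.lapply i)

/-- Applying a component to a relation gives a relation with support still inside `s`, and its
`i`-th coefficient is the component of the old one. Membership in `I ⊗ 𝒜 k` is tested by
contractions. -/
lemma relationIdeal_isThetaIdeal (T : ThetaRing Θ R) {S : Type u} [CommRing S]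
    [Algebra F S] [Algebra R S] [IsScalarTower F R S] {θS : S →+* Cga (gr S 𝒜)}
    (h : ∀ r, θS (algebraMap R S r) = mapLeft 𝒜 (IsScalarTower.toAlgHom F R S) (T.θ r))
    {ι : Type*} {c : ι → S} (hc : ∀ i, θS (c i) = algebraMap S _ (c i)) (s : Set ι) (i : ι) :
    T.IsThetaIdeal (relationIdeal c s i) := by
  rintro k _ ⟨m, ⟨hm, hs⟩, rfl⟩
  refine mem_range_of_contract_mem _ _ _ (Subtype.prop _) fun l => ?_
  refine ⟨m.mapRange (component T.θ k l) (map_zero _), ⟨?_, ?_⟩, ?_⟩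
  · rw [SetLike.mem_coe, LinearMap.mem_ker] at hm ⊢
    rw [← component_linearCombination h hc, hm, map_zero]
  · exact (Finset.coe_subset.2 Finsupp.support_mapRange).trans hs
  · rw [Finsupp.lapply_apply, Finsupp.mapRange_apply]
    rfl

/-- Linear forms separate the elements of `R ⊗ 𝒜 k`: this is the contraction criterion for the zero
ideal. -/
lemma ThetaRing.isConstant_of_component_eq_zero (T : ThetaRing Θ R) (r : R)
    (h : ∀ k ≠ 0, ∀ l, component T.θ k l r = 0) : T.IsConstant r := by
  refine Subtype.ext (PowerSeries.ext fun k => ?_)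
  rw [coeff_algebraMap]
  split_ifs with hk
  · subst hk
    exact T.θ_zero r
  · obtain ⟨x, hx⟩ := mem_range_of_contract_mem (𝒜 k) (⊥ : Ideal R) _
      ((T.θ r).2 k) fun l => h k hk l
    rw [← hx]
    have : Subsingleton ((⊥ : Ideal R).restrictScalars F) := by
      rw [Submodule.restrictScalars_bot]
      infer_instance
    rw [Subsingleton.elim x 0, map_zero]

/-- Constants of a ring over a `θ`-simple ring `R` with constants `K` which are linearly
independent over `K` are linearly independent over `R`. -/
theorem linearIndependent_of_constants [Algebra K R] [IsScalarTower K F R] (T : ThetaRing Θ R)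
    (hs : T.IsThetaSimple)
    (hK : ∀ r : R, T.IsConstant r ↔ ∃ c : K, algebraMap F R (algebraMap K F c) = r)
    {S : Type u} [CommRing S]
    [Algebra F S] [Algebra R S] [IsScalarTower F R S] [Algebra K S] [IsScalarTower K R S]
    {θS : S →+* Cga (gr S 𝒜)}
    (h : ∀ r, θS (algebraMap R S r) = mapLeft 𝒜 (IsScalarTower.toAlgHom F R S) (T.θ r))
    {ι : Type*} {c : ι → S} (hc : ∀ i, θS (c i) = algebraMap S _ (c i))
    (li : LinearIndependent K c) : LinearIndependent R c := by
  have := hs.1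
  -- Shortest-relation argument, by strong induction on the size of the support.
  have H (n : ℕ) : ∀ m : ι →₀ R, m.support.card = n → Finsupp.linearCombination R c m = 0 →
      m = 0 := by
    induction n using Nat.strong_induction_on with
    | _ n ih =>
    intro m hmn hm
    by_contra hm0
    obtain ⟨i, hi⟩ := Finsupp.support_nonempty_iff.2 hm0
    -- The `θ`-ideal contains `m i ≠ 0`, so simplicity makes it the unit ideal. This normalises the
    -- relation: `m'` is supported on `m.support` and has `m' i = 1`.
    have hI : relationIdeal c (m.support : Set ι) i = (⊤ : Ideal R) := by
      refine (hs.2 _ (relationIdeal_isThetaIdeal T h hc _ i)).resolve_left fun hI => ?_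
      have : m i ∈ relationIdeal (R := R) c (m.support : Set ι) i := 
        ⟨m, ⟨hm, (Finsupp.mem_supported R m).2 subset_rfl⟩, rfl⟩
      rw [hI] at this
      exact Finsupp.mem_support_iff.1 hi this
    obtain ⟨m', ⟨hm', hsub⟩, hm'i⟩ := (Ideal.eq_top_iff_one _).1 hI
    rw [Finsupp.lapply_apply] at hm'i
    rw [SetLike.mem_coe, LinearMap.mem_ker] at hm'
    -- Components of positive degree kill `m' i = 1`, so they yield a strictly shorter relation,
    -- which is zero by induction.
    have hcomp (k : ℕ) (hk : k ≠ 0) (l : A →ₗ[F] F) :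
        m'.mapRange (component T.θ k l) (map_zero _) = 0 := by
      refine ih _ ?_ _ rfl (by rw [← component_linearCombination h hc, hm', map_zero])
      rw [← hmn]
      refine Finset.card_lt_card ((Finset.ssubset_iff_of_subset
        (Finsupp.support_mapRange.trans (Finset.coe_subset.1 hsub))).2 ⟨i, hi, ?_⟩)
      rw [Finsupp.notMem_support_iff, Finsupp.mapRange_apply, hm'i, component_apply, map_one]
      have : PowerSeries.coeff k (1 : Cga (gr R 𝒜)).1 = 0 := by
        change PowerSeries.coeff k (1 : (R ⊗[F] A)⟦X⟧) = 0
        rw [PowerSeries.coeff_one, if_neg hk]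
      rw [this, map_zero]
    -- Thus all coefficients of `m'` are constants, and `m'` is a nontrivial relation over `K`.
    have hconst (j : ι) : ∃ a : K, algebraMap K R a = m' j := by
      simp only [IsScalarTower.algebraMap_apply K F R]
      refine (hK _).1 (T.isConstant_of_component_eq_zero _ fun k hk l => ?_)
      exact DFunLike.congr_fun (hcomp k hk l) j
    choose a ha using hconst
    have hlin : ∑ j ∈ m'.support, a j • c j = 0 := by
      rw [Finsupp.linearCombination_apply, Finsupp.sum] at hm'
      rw [← hm']
      refine Finset.sum_congr rfl fun j _ => ?_
      rw [← ha, algebraMap_smul]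
    have := linearIndependent_iff'.1 li _ _ hlin i (by simp [hm'i])
    rw [← ha, this, map_zero] at hm'i
    exact zero_ne_one hm'i
  exact linearIndependent_iff.2 fun m hm => H _ m rfl hm

end LinearDisjoint

/-! ### The tensor square and its constants -/

section Square

variable {F A : Type u} [Field F] [CommRing A] [Algebra F A] {K : Type u} [Field K] [Algebra K F]
  {𝒜 : ℕ → Submodule F A} [GradedAlgebra 𝒜] {Θ : ThetaBase K 𝒜}
  {R : Type u} [CommRing R] [Algebra F R]

lemma mapLeft_inclRight {S S' : Type u} [CommRing S] [Algebra F S] [CommRing S'] [Algebra F S']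
    (f : S →ₐ[F] S') (x : Cga 𝒜) : mapLeft 𝒜 f (inclRight S 𝒜 x) = inclRight S' 𝒜 x := by
  refine Subtype.ext (PowerSeries.ext fun k => ?_)
  change PowerSeries.coeff k (PowerSeries.map _ (PowerSeries.map _ x.1)) =
    PowerSeries.coeff k (PowerSeries.map _ x.1)
  simp [PowerSeries.coeff_map]

/-- The higher derivation `θ ⊗ θ` of the tensor square `R ⊗ R` of a `θ`-ring `R`. -/
def ThetaRing.square (T : ThetaRing Θ R) : R ⊗[F] R →+* Cga (gr (R ⊗[F] R) 𝒜) :=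
  ringLift
    ((mapLeft 𝒜 (Algebra.TensorProduct.includeLeft : R →ₐ[F] R ⊗[F] R)).comp T.θ)
    ((mapLeft 𝒜 (Algebra.TensorProduct.includeRight : R →ₐ[F] R ⊗[F] R)).comp T.θ)
    (RingHom.ext fun f => by
      simp only [RingHom.comp_apply, T.extends_base, mapLeft_inclRight])

lemma ThetaRing.square_tmul (T : ThetaRing Θ R) (r s : R) :
    T.square (r ⊗ₜ s) =
      mapLeft 𝒜 (Algebra.TensorProduct.includeLeft : R →ₐ[F] R ⊗[F] R) (T.θ r) *
      mapLeft 𝒜 (Algebra.TensorProduct.includeRight : R →ₐ[F] R ⊗[F] R) (T.θ s) :=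
  ringLift_tmul _ _ _ r s

lemma ThetaRing.square_left (T : ThetaRing Θ R) (r : R) :
    T.square (r ⊗ₜ 1) =
      mapLeft 𝒜 (Algebra.TensorProduct.includeLeft : R →ₐ[F] R ⊗[F] R) (T.θ r) := by
  rw [T.square_tmul, map_one, map_one, mul_one]

lemma ThetaRing.square_right (T : ThetaRing Θ R) (r : R) :
    T.square (1 ⊗ₜ r) =
      mapLeft 𝒜 (Algebra.TensorProduct.includeRight : R →ₐ[F] R ⊗[F] R) (T.θ r) := by
  rw [T.square_tmul, map_one, map_one, one_mul]

/-- Makes the constants stable under the interchange of factors, which provides the antipode. -/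
lemma ThetaRing.square_comm (T : ThetaRing Θ R) (x : R ⊗[F] R) :
    T.square (Algebra.TensorProduct.comm F R R x) =
      mapLeft 𝒜 (Algebra.TensorProduct.comm F R R : R ⊗[F] R →ₐ[F] R ⊗[F] R) (T.square x) := by
  induction x with
  | zero => simp
  | add x y hx hy => simp only [map_add, hx, hy]
  | tmul r s =>
    rw [Algebra.TensorProduct.comm_tmul, T.square_tmul, T.square_tmul, map_mul, ← mapLeft_comp,
      ← mapLeft_comp, mul_comm]
    congr 2

section Fundamental

variable {T : ThetaRing Θ R} {n : ℕ} {M : IterableEquation Θ n} {Y : GL (Fin n) R}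

lemma IsFundamentalMatrix.map_eq (hY : IsFundamentalMatrix T M Y) {S : Type u} [CommRing S]
    [Algebra F S] (f : R →ₐ[F] S) {θS : S →+* Cga (gr S 𝒜)}
    (h : ∀ r, θS (f r) = mapLeft 𝒜 f (T.θ r)) :
    Matrix.GeneralLinearGroup.map θS (Matrix.GeneralLinearGroup.map f.toRingHom Y) =
      Matrix.GeneralLinearGroup.map (inclRight S 𝒜) M.mat *
      Matrix.GeneralLinearGroup.map (algebraMap S (Cga (gr S 𝒜)))
        (Matrix.GeneralLinearGroup.map f.toRingHom Y) := by
  refine Units.ext (Matrix.ext fun p q => ?_)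
  refine (h _).trans ?_
  rw [hY p q, map_sum, Units.val_mul, Matrix.mul_apply]
  refine Finset.sum_congr rfl fun m _ => ?_
  rw [map_mul, mapLeft_inclRight, mapLeft_algebraMap]
  rfl

/-- The matrix `(Y ⊗ 1)⁻¹ (1 ⊗ Y)` over `R ⊗ R`. -/
def transition (F : Type u) [Field F] {R : Type u} [CommRing R] [Algebra F R] {n : ℕ}
    (Y : GL (Fin n) R) : GL (Fin n) (R ⊗[F] R) :=
  (Matrix.GeneralLinearGroup.map
    (Algebra.TensorProduct.includeLeft : R →ₐ[F] R ⊗[F] R).toRingHom Y)⁻¹ *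
  Matrix.GeneralLinearGroup.map
    (Algebra.TensorProduct.includeRight : R →ₐ[F] R ⊗[F] R).toRingHom Y

/-- `Y ⊗ 1` and `1 ⊗ Y` solve the same equation, so its matrix cancels in the quotient. -/
lemma IsFundamentalMatrix.transition_constant (hY : IsFundamentalMatrix T M Y) :
    Matrix.GeneralLinearGroup.map T.square (transition F Y) =
      Matrix.GeneralLinearGroup.map (algebraMap (R ⊗[F] R) (Cga (gr (R ⊗[F] R) 𝒜)))
        (transition F Y) := by
  have h1 := hY.map_eq (Algebra.TensorProduct.includeLeft : R →ₐ[F] R ⊗[F] R) T.square_left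
  have h2 := hY.map_eq (Algebra.TensorProduct.includeRight : R →ₐ[F] R ⊗[F] R) T.square_right
  rw [transition, map_mul, map_mul, map_inv, map_inv, h1, h2]
  group

end Fundamental

variable [Algebra K R] [IsScalarTower K F R]

/-- The algebra of constants of `R ⊗ R`. -/
def ThetaRing.squareConstants (T : ThetaRing Θ R) : Subalgebra K (R ⊗[F] R) where
  __ := T.square.eqLocus (algebraMap (R ⊗[F] R) (Cga (gr (R ⊗[F] R) 𝒜)))
  algebraMap_mem' c := by
    change T.square (algebraMap K R c ⊗ₜ 1) = algebraMap _ _ (algebraMap K R c ⊗ₜ 1)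
    rw [T.square_left, T.θ_algebraMap, mapLeft_algebraMap]
    rfl

lemma ThetaRing.mem_squareConstants {T : ThetaRing Θ R} {x : R ⊗[F] R} :
    x ∈ T.squareConstants ↔ T.square x = algebraMap _ _ x := Iff.rfl

/-- The canonical map `R ⊗ C → R ⊗ R`, where `C` is the algebra of constants of `R ⊗ R`. -/
def ThetaRing.toSquare (T : ThetaRing Θ R) : R ⊗[K] T.squareConstants →ₐ[F] R ⊗[F] R :=
  Algebra.TensorProduct.lift (Algebra.TensorProduct.includeLeft : R →ₐ[F] R ⊗[F] R)
    T.squareConstants.val fun _ _ => Commute.all _ _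

lemma ThetaRing.toSquare_tmul (T : ThetaRing Θ R) (r : R) (c : T.squareConstants) :
    T.toSquare (r ⊗ₜ c) = (r ⊗ₜ 1) * (c : R ⊗[F] R) :=
  Algebra.TensorProduct.lift_tmul _ _ _ r c

lemma ThetaRing.trivialExt_tmul (T : ThetaRing Θ R) (L : Type u) [CommRing L] [Algebra K L]
    (r : R) (a : L) :
    T.trivialExt L (r ⊗ₜ a) =
      mapLeft 𝒜 (Algebra.TensorProduct.includeLeft : R →ₐ[F] R ⊗[K] L) (T.θ r) *
      algebraMap (R ⊗[K] L) (Cga (gr (R ⊗[K] L) 𝒜)) (1 ⊗ₜ a) := by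
  have e : (r ⊗ₜ[K] a : R ⊗[K] L) = (r ⊗ₜ 1) * (1 ⊗ₜ a) := by simp
  rw [e, map_mul, T.trivialExt_left, T.trivialExt_right]

/-- A homomorphism from `R ⊗ L` commutes with higher derivations if it does so on `R` and maps `L`
to constants. -/
lemma ThetaRing.map_trivialExt (T : ThetaRing Θ R) {L : Type u} [CommRing L] [Algebra K L]
    {S : Type u} [CommRing S] [Algebra F S] {θS : S →+* Cga (gr S 𝒜)} (f : R ⊗[K] L →ₐ[F] S)
    (hl : ∀ r, θS (f (r ⊗ₜ 1)) =
      mapLeft 𝒜 (f.comp (Algebra.TensorProduct.includeLeft : R →ₐ[F] R ⊗[K] L)) (T.θ r))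
    (hr : ∀ a : L, θS (f (1 ⊗ₜ a)) = algebraMap _ _ (f (1 ⊗ₜ a))) (x : R ⊗[K] L) :
    θS (f x) = mapLeft 𝒜 f (T.trivialExt L x) := by
  induction x with
  | zero => simp only [map_zero]
  | add x y hx hy => simp only [map_add, hx, hy]
  | tmul r a =>
    have e : (r ⊗ₜ[K] a : R ⊗[K] L) = (r ⊗ₜ 1) * (1 ⊗ₜ a) := by simp
    rw [T.trivialExt_tmul, e, map_mul, map_mul, hl, hr, map_mul, ← mapLeft_comp,
      mapLeft_algebraMap]

lemma ThetaRing.toSquare_comp_includeLeft (T : ThetaRing Θ R) :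
    T.toSquare.comp (Algebra.TensorProduct.includeLeft : R →ₐ[F] R ⊗[K] T.squareConstants) =
      (Algebra.TensorProduct.includeLeft : R →ₐ[F] R ⊗[F] R) := by
  refine AlgHom.ext fun r => ?_
  exact (T.toSquare_tmul r 1).trans (mul_one _)

lemma ThetaRing.toSquare_one_tmul (T : ThetaRing Θ R) (c : T.squareConstants) :
    T.toSquare (1 ⊗ₜ c) = c :=
  (T.toSquare_tmul 1 c).trans (one_mul _)

section Simple

variable (T : ThetaRing Θ R)

/-- The constants of `R ⊗ L` are the elements of `L`. -/
lemma ThetaRing.exists_of_trivialExt_eq (hs : T.IsThetaSimple)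
    (hK : ∀ r : R, T.IsConstant r ↔ ∃ c : K, algebraMap F R (algebraMap K F c) = r)
    (L : Type u) [CommRing L] [Algebra K L] (x : R ⊗[K] L)
    (hx : T.trivialExt L x = algebraMap _ _ x) : ∃ a : L, 1 ⊗ₜ a = x := by
  have := hs.1
  let b := Module.Basis.ofVectorSpace K L
  let incl : L →ₐ[K] R ⊗[K] L := Algebra.TensorProduct.includeRight
  have hincl : Function.Injective incl :=
    Algebra.TensorProduct.includeRight_injective (FaithfulSMul.algebraMap_injective K R)
  have hb : LinearIndependent K fun i => incl (b i) :=
    b.linearIndependent.map' incl.toLinearMap (LinearMap.ker_eq_bot.2 hincl)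
  by_contra hne
  have hx' : x ∉ Submodule.span K (Set.range fun i => incl (b i)) := fun h => by
    have : Submodule.span K (Set.range fun i => incl (b i)) ≤ LinearMap.range incl.toLinearMap :=
      Submodule.span_le.2 (by rintro _ ⟨i, rfl⟩; exact ⟨b i, rfl⟩)
    obtain ⟨a, ha⟩ := this h
    exact hne ⟨a, ha⟩
  -- If `x` lay outside `1 ⊗ L`, adjoining it to a `K`-basis of `L` would give constants independent
  -- over `K`, hence over `R`. But the basis alone already spans `R ⊗ L` over `R`.
  have li : LinearIndependent R fun o : Option _ => (o.elim x fun i => incl (b i) : R ⊗[K] L) := by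
    refine linearIndependent_of_constants T hs hK (θS := T.trivialExt L) (fun r => ?_) ?_
      (linearIndependent_option.2 ⟨hb, hx'⟩)
    · exact T.trivialExt_left L r
    · rintro (_ | i)
      · exact hx
      · exact T.trivialExt_right L _
  refine (li.notMem_span_image (s := {none}ᶜ) (x := none) (by simp)) ?_
  have hspan : Submodule.span R (Set.range (b.baseChange R)) = ⊤ := (b.baseChange R).span_eq
  refine Submodule.span_mono ?_ (hspan ▸ Submodule.mem_top : x ∈ Submodule.span R _)
  rintro _ ⟨i, rfl⟩
  exact ⟨some i, by simp, (b.baseChange_apply R i).symm⟩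

/-- A `K`-basis of the constants is an `R`-basis of the source, and its image stays independent over
`R` by linear disjointness. -/
lemma ThetaRing.toSquare_injective (hs : T.IsThetaSimple)
    (hK : ∀ r : R, T.IsConstant r ↔ ∃ c : K, algebraMap F R (algebraMap K F c) = r) :
    Function.Injective T.toSquare := by
  have := hs.1
  let b := Module.Basis.ofVectorSpace K T.squareConstants
  have hb : LinearIndependent K fun i => (b i : R ⊗[F] R) :=
    b.linearIndependent.map' T.squareConstants.val.toLinearMap
      (LinearMap.ker_eq_bot.2 Subtype.val_injective)
  have li : LinearIndependent R fun i => (b i : R ⊗[F] R) :=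
    linearIndependent_of_constants T hs hK (θS := T.square) (fun r => T.square_left r)
      (fun i => (b i).2) hb
  refine (injective_iff_map_eq_zero _).2 fun x hx => ?_
  have e : T.toSquare x =
      Finsupp.linearCombination R (fun i => (b i : R ⊗[F] R)) ((b.baseChange R).repr x) := by
    conv_lhs => rw [← (b.baseChange R).linearCombination_repr x]
    simp only [Finsupp.linearCombination_apply, Finsupp.sum, map_sum]
    refine Finset.sum_congr rfl fun i _ => ?_
    rw [Module.Basis.baseChange_apply, TensorProduct.smul_tmul', smul_eq_mul, mul_one,
      T.toSquare_tmul, Algebra.smul_def]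
    rfl
  rw [e] at hx
  exact (b.baseChange R).repr.map_eq_zero_iff.1 (linearIndependent_iff.1 li _ hx)

end Simple

/-- The image contains `R ⊗ 1` and all constants, hence by `1 ⊗ Y = (Y ⊗ 1) * transition F Y` the
generators of `1 ⊗ R`. -/
lemma ThetaRing.toSquare_surjective {T : ThetaRing Θ R} {n : ℕ} {M : IterableEquation Θ n}
    {Y : GL (Fin n) R} (hY : IsFundamentalMatrix T M Y)
    (hgen : Algebra.adjoin F ({r | ∃ p q, r = Y p q} ∪
      {(((Matrix.GeneralLinearGroup.det Y)⁻¹ : Rˣ) : R)}) = ⊤) :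
    Function.Surjective T.toSquare := by
  have hl (r : R) : r ⊗ₜ 1 ∈ T.toSquare.range := ⟨r ⊗ₜ 1, by simp [T.toSquare_tmul]⟩
  have hc (x) (hx : x ∈ T.squareConstants) : x ∈ T.toSquare.range :=
    ⟨1 ⊗ₜ ⟨x, hx⟩, (T.toSquare_tmul 1 ⟨x, hx⟩).trans (one_mul x)⟩
  have hmul : Matrix.GeneralLinearGroup.map
      (Algebra.TensorProduct.includeRight : R →ₐ[F] R ⊗[F] R).toRingHom Y =
      Matrix.GeneralLinearGroup.map
        (Algebra.TensorProduct.includeLeft : R →ₐ[F] R ⊗[F] R).toRingHom Y * transition F Y := by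
    rw [transition, mul_inv_cancel_left]
  have hr : Algebra.adjoin F ({r | ∃ p q, r = Y p q} ∪
      {(((Matrix.GeneralLinearGroup.det Y)⁻¹ : Rˣ) : R)}) ≤
      T.toSquare.range.comap (Algebra.TensorProduct.includeRight : R →ₐ[F] R ⊗[F] R) := by
    refine Algebra.adjoin_le (Set.union_subset ?_ (Set.singleton_subset_iff.2 ?_))
    · rintro _ ⟨p, q, rfl⟩
      have e := congrArg (fun g : GL (Fin n) (R ⊗[F] R) => g p q) hmul
      change 1 ⊗ₜ Y p q = _ at e
      change 1 ⊗ₜ Y p q ∈ T.toSquare.range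
      rw [e]
      simp only [Units.val_mul, Matrix.mul_apply]
      refine Subalgebra.sum_mem _ fun m _ => Subalgebra.mul_mem _ (hl (Y p m)) (hc _ ?_)
      exact congrArg (fun g : GL (Fin n) (Cga (gr (R ⊗[F] R) 𝒜)) => g m q) hY.transition_constant
    -- The inverse determinant factors in the same way, and that of the transition matrix is again
    -- constant.
    · have e := congrArg (fun g => (Matrix.GeneralLinearGroup.det g)⁻¹) hmul
      simp only [map_mul, mul_inv, Matrix.GeneralLinearGroup.map_det, ← map_inv] at e
      replace e := congrArg Units.val e
      change 1 ⊗ₜ _ = _ at e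
      change 1 ⊗ₜ _ ∈ T.toSquare.range
      rw [← map_inv, e]
      refine Subalgebra.mul_mem _ (hl _) (hc _ ?_)
      have h := congrArg (fun g => Matrix.GeneralLinearGroup.det g⁻¹) hY.transition_constant
      simp only [← map_inv, Matrix.GeneralLinearGroup.map_det] at h
      exact congrArg Units.val h
  intro x
  have : x ∈ T.toSquare.range := by
    induction x with
    | zero => exact zero_mem _
    | add x y hx hy => exact add_mem hx hy
    | tmul r s =>
      have e : (r ⊗ₜ[F] s : R ⊗[F] R) = (r ⊗ₜ 1) * (1 ⊗ₜ s) := by simp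
      rw [e]
      exact mul_mem (hl r) (hr (hgen ▸ Algebra.mem_top : s ∈ Algebra.adjoin F _))
  exact this

end Square

/-! ### Representability of the Galois group functor -/

section Representability

variable {F A : Type u} [Field F] [CommRing A] [Algebra F A] {K : Type u} [Field K] [Algebra K F]
  {𝒜 : ℕ → Submodule F A} [GradedAlgebra 𝒜] {Θ : ThetaBase K 𝒜}
  {R : Type u} [CommRing R] [Algebra K R] [Algebra F R] [IsScalarTower K F R]

/-- A splitting `R ⊗ C ≃ R ⊗ R` of the tensor square, with `C` consisting of constants and
stable under the interchange of the factors of `R ⊗ R`. -/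
structure SquareSplitting (T : ThetaRing Θ R) (C : Type u) [CommRing C] [Algebra K C] where
  /-- the isomorphism `R ⊗ C ≃ R ⊗ R` -/
  equiv : R ⊗[K] C ≃ₐ[F] R ⊗[F] R
  equiv_left : ∀ r, equiv (r ⊗ₜ 1) = r ⊗ₜ 1
  equiv_right : ∀ c : C, T.square (equiv (1 ⊗ₜ c)) = algebraMap _ _ (equiv (1 ⊗ₜ c))
  /-- the automorphism of `C` induced by the interchange of the factors -/
  antipode : C ≃ₐ[K] C
  equiv_antipode : ∀ c : C,
    Algebra.TensorProduct.comm F R R (equiv (1 ⊗ₜ antipode c)) = equiv (1 ⊗ₜ c)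

section MulHom

variable {L : Type u} [CommRing L] [Algebra K L]

/-- The homomorphism `R ⊗ R → R ⊗ L`, `r ⊗ s ↦ r σ(s)`. -/
def mulHom (σ : (R ⊗[K] L) →ₐ[F] (R ⊗[K] L)) : R ⊗[F] R →ₐ[F] R ⊗[K] L :=
  Algebra.TensorProduct.lift (Algebra.TensorProduct.includeLeft : R →ₐ[F] R ⊗[K] L)
    (σ.comp (Algebra.TensorProduct.includeLeft : R →ₐ[F] R ⊗[K] L)) fun _ _ => Commute.all _ _

lemma mulHom_tmul (σ : (R ⊗[K] L) →ₐ[F] (R ⊗[K] L)) (r s : R) :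
    mulHom σ (r ⊗ₜ s) = (r ⊗ₜ 1) * σ (s ⊗ₜ 1) :=
  Algebra.TensorProduct.lift_tmul _ _ _ r s

lemma mulHom_one_tmul (σ : (R ⊗[K] L) →ₐ[F] (R ⊗[K] L)) (s : R) :
    mulHom σ (1 ⊗ₜ s) = σ (s ⊗ₜ 1) := by
  rw [mulHom_tmul]
  exact one_mul _

lemma mulHom_tmul_one (σ : (R ⊗[K] L) →ₐ[F] (R ⊗[K] L)) (r : R) :
    mulHom σ (r ⊗ₜ 1) = r ⊗ₜ 1 := by
  rw [mulHom_tmul, ← Algebra.TensorProduct.one_def, map_one, mul_one]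

/-- Consequently `mulHom σ` carries constants of `R ⊗[F] R` to constants of `R ⊗[K] L`. -/
lemma ThetaRing.trivialExt_mulHom (T : ThetaRing Θ R) (σ : (R ⊗[K] L) →ₐ[F] (R ⊗[K] L))
    (h : ∀ x, T.trivialExt L (σ x) = mapLeft 𝒜 σ (T.trivialExt L x)) (x : R ⊗[F] R) :
    T.trivialExt L (mulHom σ x) = mapLeft 𝒜 (mulHom σ) (T.square x) := by
  induction x with
  | zero => simp only [map_zero]
  | add x y hx hy => simp only [map_add, hx, hy]
  | tmul r s =>
    have e1 : (mulHom σ).comp (Algebra.TensorProduct.includeLeft : R →ₐ[F] R ⊗[F] R) =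
        (Algebra.TensorProduct.includeLeft : R →ₐ[F] R ⊗[K] L) :=
      AlgHom.ext (mulHom_tmul_one σ)
    have e2 : (mulHom σ).comp (Algebra.TensorProduct.includeRight : R →ₐ[F] R ⊗[F] R) =
        σ.comp (Algebra.TensorProduct.includeLeft : R →ₐ[F] R ⊗[K] L) :=
      AlgHom.ext (mulHom_one_tmul σ)
    rw [T.square_tmul, mulHom_tmul, map_mul, map_mul, ← mapLeft_comp, ← mapLeft_comp, e1, e2, h,
      mapLeft_comp, T.trivialExt_left, T.trivialExt_left]

lemma mulHom_id (x : R ⊗[F] R) :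
    mulHom (AlgHom.id F (R ⊗[K] L)) x = Algebra.TensorProduct.lmul' F x ⊗ₜ 1 := by
  induction x with
  | zero => simp
  | add x y hx hy => simp only [map_add, hx, hy, TensorProduct.add_tmul]
  | tmul r s => simp [mulHom_tmul]

end MulHom

namespace SquareSplitting

variable {T : ThetaRing Θ R} {C : Type u} [CommRing C] [Algebra K C] (Q : SquareSplitting T C)

lemma equiv_tmul (r : R) (c : C) : Q.equiv (r ⊗ₜ c) = (r ⊗ₜ 1) * Q.equiv (1 ⊗ₜ c) := by
  rw [← Q.equiv_left, ← map_mul]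
  simp

lemma square_equiv (x : R ⊗[K] C) :
    T.square (Q.equiv x) =
      mapLeft 𝒜 (Q.equiv : R ⊗[K] C →ₐ[F] R ⊗[F] R) (T.trivialExt C x) := by
  refine T.map_trivialExt (Q.equiv : R ⊗[K] C →ₐ[F] R ⊗[F] R) (fun r => ?_) Q.equiv_right x
  have e : (Q.equiv : R ⊗[K] C →ₐ[F] R ⊗[F] R).comp
      (Algebra.TensorProduct.includeLeft : R →ₐ[F] R ⊗[K] C) =
      (Algebra.TensorProduct.includeLeft : R →ₐ[F] R ⊗[F] R) := AlgHom.ext Q.equiv_left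
  rw [e, ← T.square_left, ← Q.equiv_left]
  rfl

lemma trivialExt_symm (y : R ⊗[F] R) :
    T.trivialExt C (Q.equiv.symm y) =
      mapLeft 𝒜 (Q.equiv.symm : R ⊗[F] R →ₐ[F] R ⊗[K] C) (T.square y) := by
  have e : (Q.equiv.symm : R ⊗[F] R →ₐ[F] R ⊗[K] C).comp
      (Q.equiv : R ⊗[K] C →ₐ[F] R ⊗[F] R) = AlgHom.id F _ :=
    AlgHom.ext fun x => Q.equiv.symm_apply_apply x
  have h := Q.square_equiv (Q.equiv.symm y)
  rw [AlgEquiv.apply_symm_apply] at h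
  rw [h, ← mapLeft_comp, e, mapLeft_id]

/-- The universal automorphism, `r ⊗ c ↦ (1 ⊗ r) c` under the identification of `R ⊗ C` with
`R ⊗ R`. -/
def universalEquiv : (R ⊗[K] C) ≃ₐ[F] (R ⊗[K] C) :=
  -- The interchange sends `R ⊗ 1` to `1 ⊗ R` but moves `C`; applying the antipode first compensates
  -- for this. Bijectivity is then automatic.
  (Algebra.TensorProduct.congr (AlgEquiv.refl : R ≃ₐ[F] R) Q.antipode).trans
    ((Q.equiv.trans (Algebra.TensorProduct.comm F R R)).trans Q.equiv.symm)

lemma equiv_universalEquiv_tmul (r : R) (c : C) :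
    Q.equiv (Q.universalEquiv (r ⊗ₜ c)) = (1 ⊗ₜ r) * Q.equiv (1 ⊗ₜ c) := by
  have : Q.universalEquiv (r ⊗ₜ c) =
    Q.equiv.symm (Algebra.TensorProduct.comm F R R (Q.equiv (r ⊗ₜ Q.antipode c))) := rfl
  rw [this, AlgEquiv.apply_symm_apply, Q.equiv_tmul, map_mul, Q.equiv_antipode,
    Algebra.TensorProduct.comm_tmul]

lemma equiv_universalEquiv_left (r : R) : Q.equiv (Q.universalEquiv (r ⊗ₜ 1)) = 1 ⊗ₜ r := by
  rw [Q.equiv_universalEquiv_tmul, Q.equiv_left, ← Algebra.TensorProduct.one_def, mul_one]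

lemma universalEquiv_right (c : C) : Q.universalEquiv (1 ⊗ₜ c) = 1 ⊗ₜ c := by
  refine Q.equiv.injective ?_
  rw [Q.equiv_universalEquiv_tmul, ← Algebra.TensorProduct.one_def, one_mul]

lemma universalEquiv_left (r : R) :
    Q.universalEquiv (r ⊗ₜ 1) = Q.equiv.symm (1 ⊗ₜ r) := by
  rw [← Q.equiv_universalEquiv_left, AlgEquiv.symm_apply_apply]

/-- The universal element of the Galois group scheme. -/
def universal : thetaAut T C :=
  ⟨Q.universalEquiv, Q.universalEquiv_right, fun x => by
    refine T.map_trivialExt (Q.universalEquiv : R ⊗[K] C →ₐ[F] R ⊗[K] C) (fun r => ?_)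
      (fun c => ?_) x
    · have e : (Q.universalEquiv : R ⊗[K] C →ₐ[F] R ⊗[K] C).comp
          (Algebra.TensorProduct.includeLeft : R →ₐ[F] R ⊗[K] C) =
          (Q.equiv.symm : R ⊗[F] R →ₐ[F] R ⊗[K] C).comp
            (Algebra.TensorProduct.includeRight : R →ₐ[F] R ⊗[F] R) :=
        AlgHom.ext Q.universalEquiv_left
      rw [e, mapLeft_comp, ← T.square_right, ← Q.trivialExt_symm]
      exact congrArg _ (Q.universalEquiv_left r)
    · have e : (Q.universalEquiv : R ⊗[K] C →ₐ[F] R ⊗[K] C) (1 ⊗ₜ c) = 1 ⊗ₜ c :=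
        Q.universalEquiv_right c
      rw [e, T.trivialExt_right]⟩

variable {L : Type u} [CommRing L] [Algebra K L]

lemma map_eq_mulHom (f : C →ₐ[K] L) (σ : (R ⊗[K] L) →ₐ[F] (R ⊗[K] L))
    (h : ∀ c, 1 ⊗ₜ f c = mulHom σ (Q.equiv (1 ⊗ₜ c))) (x : R ⊗[K] C) :
    Algebra.TensorProduct.map (AlgHom.id F R) f x = mulHom σ (Q.equiv x) := by
  induction x with
  | zero => simp only [map_zero]
  | add x y hx hy => simp only [map_add, hx, hy]
  | tmul r c =>
    rw [Q.equiv_tmul, map_mul, ← h, mulHom_tmul_one, Algebra.TensorProduct.map_tmul,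
      Algebra.TensorProduct.tmul_mul_tmul, mul_one, one_mul, AlgHom.id_apply]

lemma thetaAutMap_universal_left (f : C →ₐ[K] L) (r : R) :
    (thetaAutMap T f Q.universal).1 (r ⊗ₜ 1) =
      Algebra.TensorProduct.map (AlgHom.id F R) f (Q.equiv.symm (1 ⊗ₜ r)) := by
  rw [← Q.universalEquiv_left]
  refine (baseChangeHom_tmul f _ r 1).trans ?_
  exact mul_one _

lemma mulHom_thetaAutMap_universal (f : C →ₐ[K] L) (y : R ⊗[F] R) :
    mulHom ((thetaAutMap T f Q.universal).1 : (R ⊗[K] L) →ₐ[F] (R ⊗[K] L)) y =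
      Algebra.TensorProduct.map (AlgHom.id F R) f (Q.equiv.symm y) := by
  induction y with
  | zero => simp only [map_zero]
  | add x y hx hy => simp only [map_add, hx, hy]
  | tmul r s =>
    have e : (r ⊗ₜ[F] s : R ⊗[F] R) = Q.equiv (r ⊗ₜ 1) * (1 ⊗ₜ s) := by
      simp [Q.equiv_left]
    have e1 := Q.thetaAutMap_universal_left f s
    rw [mulHom_tmul]
    refine (congrArg _ e1).trans ?_
    rw [e, map_mul, AlgEquiv.symm_apply_apply, map_mul, Algebra.TensorProduct.map_tmul, map_one,
      AlgHom.id_apply]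

/-- `σ` is obtained from the universal element by base change along `f` if and only if `f` is the
restriction of `r ⊗ s ↦ r σ(s)` to constants. -/
lemma thetaAutMap_universal_eq_iff (f : C →ₐ[K] L) (σ : thetaAut T L) :
    thetaAutMap T f Q.universal = σ ↔
      ∀ c, 1 ⊗ₜ f c = mulHom (σ.1 : (R ⊗[K] L) →ₐ[F] (R ⊗[K] L)) (Q.equiv (1 ⊗ₜ c)) := by
  constructor
  · rintro rfl c
    rw [mulHom_thetaAutMap_universal, AlgEquiv.symm_apply_apply, Algebra.TensorProduct.map_tmul,
      map_one]
  · intro h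
    -- Both automorphisms fix `1 ⊗ L`, so it suffices to compare them on `R ⊗ 1`.
    have hl (r : R) : (thetaAutMap T f Q.universal).1 (r ⊗ₜ 1) = σ.1 (r ⊗ₜ 1) := by
      rw [Q.thetaAutMap_universal_left, Q.map_eq_mulHom f _ h, AlgEquiv.apply_symm_apply,
        mulHom_one_tmul]
      rfl
    refine Subtype.ext (AlgEquiv.ext fun x => ?_)
    induction x with
    | zero => simp only [map_zero]
    | add x y hx hy => simp only [map_add, hx, hy]
    | tmul r a =>
      have e : (r ⊗ₜ[K] a : R ⊗[K] L) = (r ⊗ₜ 1) * (1 ⊗ₜ a) := by simp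
      rw [e, map_mul, map_mul, hl, σ.2.1, (thetaAutMap T f Q.universal).2.1]

/-- A homomorphism `f` is determined by `c ↦ 1 ⊗ f c` because `L` embeds in `R ⊗ L`. Conversely,
`mulHom σ` sends `C` to constants of `R ⊗ L`, that is into `L`, and this defines `f`. -/
lemma thetaAutMap_universal_bijective (hs : T.IsThetaSimple)
    (hK : ∀ r : R, T.IsConstant r ↔ ∃ c : K, algebraMap F R (algebraMap K F c) = r) :
    Function.Bijective fun f : C →ₐ[K] L => thetaAutMap T f Q.universal := by
  have := hs.1
  let incl : L →ₐ[K] R ⊗[K] L := Algebra.TensorProduct.includeRight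
  have hincl : Function.Injective incl :=
    Algebra.TensorProduct.includeRight_injective (FaithfulSMul.algebraMap_injective K R)
  refine ⟨fun f g h => AlgHom.ext fun c => hincl ?_, fun σ => ?_⟩
  · exact ((Q.thetaAutMap_universal_eq_iff f _).1 h c).trans
      ((Q.thetaAutMap_universal_eq_iff g _).1 rfl c).symm
  · have hex (c : C) : ∃ a : L, 1 ⊗ₜ a =
        mulHom (σ.1 : (R ⊗[K] L) →ₐ[F] (R ⊗[K] L)) (Q.equiv (1 ⊗ₜ c)) := by
      refine T.exists_of_trivialExt_eq hs hK L _ ?_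
      rw [T.trivialExt_mulHom _ σ.2.2, Q.equiv_right, mapLeft_algebraMap]
    choose f hf using hex
    have hone : f 1 = 1 := hincl <| (hf 1).trans <| by
      rw [← Algebra.TensorProduct.one_def, map_one, map_one, map_one]
    refine ⟨AlgHom.ofLinearMap
      { toFun := f
        map_add' := fun a b => hincl ?_
        map_smul' := fun k a => hincl ?_ } hone fun a b => hincl ?_,
      (Q.thetaAutMap_universal_eq_iff _ _).2 hf⟩
    · rw [map_add]
      refine (hf _).trans ?_
      rw [TensorProduct.tmul_add, map_add, map_add, ← hf, ← hf]
      rfl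
    · rw [RingHom.id_apply, map_smul]
      refine (hf _).trans ?_
      -- The maps involved are bundled as `F`-linear, so the scalar `k` is passed through `F`.
      rw [TensorProduct.tmul_smul, ← algebraMap_smul F k, map_smul, map_smul, ← hf,
        algebraMap_smul]
      rfl
    · refine (hf _).trans (Eq.trans ?_ (map_mul incl _ _).symm)
      have e : ((1 : R) ⊗ₜ[K] (a * b) : R ⊗[K] C) = (1 ⊗ₜ a) * (1 ⊗ₜ b) := by simp
      rw [e, map_mul, map_mul, ← hf, ← hf]
      rfl

open CategoryTheory

/-- The Galois group scheme is represented by `C`. -/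
def corepresentableBy (hs : T.IsThetaSimple)
    (hK : ∀ r : R, T.IsConstant r ↔ ∃ c : K, algebraMap F R (algebraMap K F c) = r) :
    (galoisGroup T ⋙ forget GrpCat.{u}).CorepresentableBy (CommAlgCat.of K C) where
  homEquiv {L} := 
    ({ toFun := fun f => f.hom
       invFun := fun f => CommAlgCat.ofHom f
       left_inv := fun _ => rfl
       right_inv := fun _ => rfl } : (CommAlgCat.of K C ⟶ L) ≃ (C →ₐ[K] L)).trans
    (Equiv.ofBijective _ (Q.thetaAutMap_universal_bijective (L := L) hs hK))
  homEquiv_comp g f := thetaAutMap_comp T g.hom f.hom Q.universal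

/-- The augmentation of `C` is induced by the multiplication of `R`. -/
lemma algebraMap_augmentation (hs : T.IsThetaSimple)
    (hK : ∀ r : R, T.IsConstant r ↔ ∃ c : K, algebraMap F R (algebraMap K F c) = r) (c : C) :
    algebraMap K R (augmentation (Q.corepresentableBy hs hK) c) =
      Algebra.TensorProduct.lmul' F (Q.equiv (1 ⊗ₜ c)) := by
  have h : thetaAutMap T (augmentation (Q.corepresentableBy hs hK)) Q.universal = 1 :=
    (Q.corepresentableBy hs hK).homEquiv.apply_symm_apply
      (1 : (galoisGroup T).obj (CommAlgCat.of K K))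
  have h2 := (Q.thetaAutMap_universal_eq_iff _ _).1 h c
  have h3 : mulHom (((1 : thetaAut T K).1) : (R ⊗[K] K) →ₐ[F] (R ⊗[K] K)) =
    mulHom (AlgHom.id F (R ⊗[K] K)) := rfl
  rw [h3, mulHom_id] at h2
  have h4 := congrArg (TensorProduct.rid K R) h2
  rw [TensorProduct.rid_tmul, TensorProduct.rid_tmul, one_smul] at h4
  rw [← h4, Algebra.algebraMap_eq_smul_one]

end SquareSplitting

/-- The automorphism of the algebra of constants of `R ⊗ R` given by the interchange of the
factors. -/
def ThetaRing.squareSwap (T : ThetaRing Θ R) : T.squareConstants ≃ₐ[K] T.squareConstants :=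
  have hc (x : R ⊗[F] R) (hx : x ∈ T.squareConstants) :
      Algebra.TensorProduct.comm F R R x ∈ T.squareConstants := by
    rw [mem_squareConstants] at hx ⊢
    rw [T.square_comm, hx, mapLeft_algebraMap]
    rfl
  { toFun := fun c => ⟨Algebra.TensorProduct.comm F R R c, hc _ c.2⟩
    invFun := fun c => ⟨Algebra.TensorProduct.comm F R R c, hc _ c.2⟩
    left_inv := fun c => Subtype.ext (TensorProduct.comm_comm F R R c.1)
    right_inv := fun c => Subtype.ext (TensorProduct.comm_comm F R R c.1)
    map_mul' := fun a b => Subtype.ext (map_mul (Algebra.TensorProduct.comm F R R) a.1 b.1)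
    map_add' := fun a b => Subtype.ext (map_add (Algebra.TensorProduct.comm F R R) a.1 b.1)
    commutes' := fun k => Subtype.ext <| by
      change Algebra.TensorProduct.comm F R R (algebraMap K (R ⊗[F] R) k) =
        algebraMap K (R ⊗[F] R) k
      rw [IsScalarTower.algebraMap_apply K F (R ⊗[F] R), AlgEquiv.commutes] }

lemma ThetaRing.comm_squareSwap (T : ThetaRing Θ R) (c : T.squareConstants) :
    Algebra.TensorProduct.comm F R R (T.squareSwap c) = c :=
  TensorProduct.comm_comm F R R c.1

/-- The splitting of the tensor square by its algebra of constants. -/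
def ThetaRing.squareSplitting (T : ThetaRing Θ R) (h : Function.Bijective T.toSquare) :
    SquareSplitting T T.squareConstants where
  equiv := AlgEquiv.ofBijective T.toSquare h
  equiv_left r := AlgHom.congr_fun T.toSquare_comp_includeLeft r
  equiv_right c := by
    rw [AlgEquiv.coe_ofBijective, T.toSquare_one_tmul]
    exact c.2
  antipode := T.squareSwap
  equiv_antipode c := by
    rw [AlgEquiv.coe_ofBijective, T.toSquare_one_tmul, T.toSquare_one_tmul, T.comm_squareSwap]

end Representability

/-! ### Independence of the representing algebra -/

section InfinitesimalCriterion

open CategoryTheory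

variable {K : Type u} [Field K] {G : CommAlgCat.{u} K ⥤ GrpCat.{u}}

/-- By Yoneda the isomorphism respects the identifications with `G(K)`, and both augmentations
correspond to the neutral element there. -/
lemma uniqueUpToIso_hom_augmentation {H H' : CommAlgCat.{u} K}
    (e : (G ⋙ forget GrpCat.{u}).CorepresentableBy H)
    (e' : (G ⋙ forget GrpCat.{u}).CorepresentableBy H') (x : H) :
    augmentation e' ((e.uniqueUpToIso e').hom x) = augmentation e x := by
  let one : (G ⋙ forget GrpCat.{u}).obj (CommAlgCat.of K K) :=
    (1 : G.obj (CommAlgCat.of K K))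
  have h : (e.uniqueUpToIso e').hom ≫ e'.homEquiv.symm one = e.homEquiv.symm one := by
    have h0 : (e.uniqueUpToIso e').hom = e.homEquiv.symm (e'.homEquiv (𝟙 _)) := rfl
    rw [h0, e.homEquiv_symm_comp, ← e'.homEquiv_comp, Category.id_comp, Equiv.apply_symm_apply]
  exact congrArg (fun f => f.hom x) h

/-- Being infinitesimal can be tested on any representing algebra. -/
lemma isInfinitesimal_iff {H : CommAlgCat.{u} K}
    (e : (G ⋙ forget GrpCat.{u}).CorepresentableBy H) :
    IsInfinitesimal G ↔ Module.Finite K H ∧ IsNilpotent (RingHom.ker (augmentation e)) := by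
  refine ⟨?_, fun h => ⟨H, e, h⟩⟩
  rintro ⟨H', e', hfin, n, hn⟩
  let i : H' ≃ₐ[K] H := CommAlgCat.algEquivOfIso (e'.uniqueUpToIso e)
  have hi (x : H') : augmentation e (i x) = augmentation e' x :=
    uniqueUpToIso_hom_augmentation e' e x
  refine ⟨Module.Finite.equiv i.toLinearEquiv, n, ?_⟩
  have hle : RingHom.ker (augmentation e) ≤ (RingHom.ker (augmentation e')).map i := by
    intro c hc
    rw [← i.apply_symm_apply c]
    refine Ideal.mem_map_of_mem _ ?_
    rw [RingHom.mem_ker, ← hi, i.apply_symm_apply]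
    exact hc
  rw [Ideal.zero_eq_bot, ← le_bot_iff]
  refine (Ideal.pow_right_mono hle n).trans ?_
  rw [← Ideal.map_pow, hn, Ideal.zero_eq_bot, Ideal.map_bot]

end InfinitesimalCriterion

/-! ### Pure inseparability and the kernel of multiplication -/

section PurelyInseparable

variable {F R : Type*} [Field F] [CommRing R] [Algebra F R] (E : Type*) [Field E] [Algebra R E]
  [IsFractionRing R E] [Algebra F E] [IsScalarTower F R E]

/-- If the quotient field of `R` is purely inseparable over `F`, then the kernel of the
multiplication `R ⊗ R → R` is nil. -/
lemma ker_lmul'_le_nilradical [IsPurelyInseparable F E] :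
    RingHom.ker (Algebra.TensorProduct.lmul' F (S := R)) ≤ nilradical (R ⊗[F] R) := by
  have hinj := IsFractionRing.injective R E
  change KaehlerDifferential.ideal F R ≤ _
  rw [← KaehlerDifferential.span_range_eq_ideal, Ideal.span_le]
  -- It suffices to treat the differences of `1 ⊗ r` and `r ⊗ 1`, which generate the kernel.
  rintro _ ⟨r, rfl⟩
  obtain ⟨q, hq⟩ := ExpChar.exists F
  have : ExpChar (R ⊗[F] R) q := by
    have : Nontrivial R := (algebraMap R E).domain_nontrivial
    exact expChar_of_injective_algebraMap (FaithfulSMul.algebraMap_injective F (R ⊗[F] R)) q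
  obtain ⟨n, a, ha⟩ := IsPurelyInseparable.pow_mem F q (algebraMap R E r)
  have hr : r ^ q ^ n = algebraMap F R a := hinj <| by
    rw [map_pow, ← ha, ← IsScalarTower.algebraMap_apply]
  refine ⟨q ^ n, ?_⟩
  -- Taking `q ^ n`-th powers is additive, and `r ^ q ^ n` lies in `F`, so it moves across the
  -- tensor sign and the difference vanishes.
  rw [sub_pow_expChar_pow, Algebra.TensorProduct.tmul_pow, Algebra.TensorProduct.tmul_pow, hr,
    one_pow, Algebra.TensorProduct.tmul_one_eq_one_tmul, sub_self]
  rfl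

/-- If the kernel of the multiplication `R ⊗ R → R` is nil, then the quotient field of `R` is
purely inseparable over `F`. -/
lemma isPurelyInseparable_of_ker_lmul'_le_nilradical
    (h : RingHom.ker (Algebra.TensorProduct.lmul' F (S := R)) ≤ nilradical (R ⊗[F] R)) :
    IsPurelyInseparable F E := by
  rw [isPurelyInseparable_iff_subsingleton_emb]
  refine ⟨fun f g => ?_⟩
  let i := IsScalarTower.toAlgHom F R E
  -- Two embeddings of `E` combine to `r ⊗ s ↦ f(r) g(s)`. A field has no nilpotents, so `m` kills
  -- `r ⊗ 1 - 1 ⊗ r`, and `f`, `g` agree on `R`.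
  let m : R ⊗[F] R →ₐ[F] AlgebraicClosure E :=
    Algebra.TensorProduct.lift (f.comp i) (g.comp i) fun _ _ => Commute.all _ _
  have key (r : R) : f (algebraMap R E r) = g (algebraMap R E r) := by
    have hr : r ⊗ₜ[F] 1 - 1 ⊗ₜ[F] r ∈ RingHom.ker (Algebra.TensorProduct.lmul' F (S := R)) := by
      simp [RingHom.mem_ker]
    have h0 : m (r ⊗ₜ[F] 1 - 1 ⊗ₜ[F] r) = 0 := (IsNilpotent.map (h hr) m).eq_zero
    have h1 : m (r ⊗ₜ[F] 1 - 1 ⊗ₜ[F] r) = f (algebraMap R E r) - g (algebraMap R E r) := by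
      simp [m, i]
    exact sub_eq_zero.1 (h1.symm.trans h0)
  have : (f : E →+* AlgebraicClosure E) = g :=
    IsLocalization.ringHom_ext (nonZeroDivisors R) (RingHom.ext key)
  exact AlgHom.ext fun x => DFunLike.congr_fun this x

end PurelyInseparable

/-! ### Transfer between the tensor square and the representing algebra -/

section Main

variable {F A : Type u} [Field F] [CommRing A] [Algebra F A] {K : Type u} [Field K] [Algebra K F]
  {𝒜 : ℕ → Submodule F A} [GradedAlgebra 𝒜] {Θ : ThetaBase K 𝒜}
  {R : Type u} [CommRing R] [Algebra K R] [Algebra F R] [IsScalarTower K F R]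

namespace SquareSplitting

variable {T : ThetaRing Θ R} {C : Type u} [CommRing C] [Algebra K C]

/-- Modulo nilpotents every `c` equals the scalar `ε c`, so every `y` in `R ⊗ C` is congruent to its
product in `R`; it is nilpotent if that product is zero. -/
lemma ker_lmul'_le_nilradical (Q : SquareSplitting T C) (ε : C →ₐ[K] K)
    (hε : ∀ c, algebraMap K R (ε c) = Algebra.TensorProduct.lmul' F (Q.equiv (1 ⊗ₜ c)))
    (h : RingHom.ker ε ≤ nilradical C) :
    RingHom.ker (Algebra.TensorProduct.lmul' F (S := R)) ≤ nilradical (R ⊗[F] R) := by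
  have key (y : R ⊗[K] C) :
      y - Algebra.TensorProduct.lmul' F (Q.equiv y) ⊗ₜ 1 ∈ nilradical (R ⊗[K] C) := by
    induction y with
    | zero => simp
    | add x y hx hy =>
      rw [map_add, map_add, TensorProduct.add_tmul, add_sub_add_comm]
      exact add_mem hx hy
    | tmul r c =>
      have hc : c - algebraMap K C (ε c) ∈ nilradical C := h (by simp [RingHom.mem_ker])
      have e : r ⊗ₜ[K] c - Algebra.TensorProduct.lmul' F (Q.equiv (r ⊗ₜ[K] c)) ⊗ₜ[K] 1 =
          (r ⊗ₜ 1) * (Algebra.TensorProduct.includeRight : C →ₐ[K] R ⊗[K] C)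
            (c - algebraMap K C (ε c)) := by
        rw [Q.equiv_tmul, map_mul, ← hε, Algebra.TensorProduct.lmul'_apply_tmul, mul_one,
          Algebra.TensorProduct.includeRight_apply, TensorProduct.tmul_sub, mul_sub,
          ← Algebra.TensorProduct.tmul_one_eq_one_tmul]
        simp
      rw [e]
      exact Ideal.mul_mem_left _ _ (IsNilpotent.map hc _)
  intro x hx
  have := key (Q.equiv.symm x)
  rw [AlgEquiv.apply_symm_apply, (hx : Algebra.TensorProduct.lmul' F x = 0),
    TensorProduct.zero_tmul, sub_zero] at this
  have h := IsNilpotent.map this Q.equiv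
  rwa [AlgEquiv.apply_symm_apply] at h

/-- `R ⊗[F] R` is finite over `F`, hence so is `R ⊗[K] C`, which is then finite over `R`. A
`K`-basis of `C` becomes an `R`-basis there, so it is finite. -/
lemma finite (Q : SquareSplitting T C) [Nontrivial R] [Module.Finite F R] : Module.Finite K C := by
  have : Module.Finite F (R ⊗[K] C) := Module.Finite.equiv Q.equiv.symm.toLinearEquiv
  have : Module.Finite R (R ⊗[K] C) := Module.Finite.of_restrictScalars_finite F R _
  let b := Module.Basis.ofVectorSpace K C
  have := Module.Finite.finite_basis (b.baseChange R)
  exact Module.Finite.of_basis b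

end SquareSplitting

end Main

end PPV

end

theorem corollary10p4 {K F A R E : Type u} [Field K] [Field F] [Algebra K F]
    [CommRing A] [Algebra F A] (𝒜 : ℕ → Submodule F A) [GradedAlgebra 𝒜]
    (Θ : PPV.ThetaBase K 𝒜)
    [CommRing R] [Algebra K R] [Algebra F R] [IsScalarTower K F R]
    (T : PPV.ThetaRing Θ R) {n : ℕ} (M : PPV.IterableEquation Θ n) (hR : PPV.IsPPVRing T M)
    [Field E] [Algebra R E] [IsFractionRing R E] [Algebra F E] [IsScalarTower F R E] :
    IsPurelyInseparable F E ↔ PPV.IsInfinitesimal (PPV.galoisGroup T) := by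
  obtain ⟨Y, hY, hgen⟩ := hR.exists_fundamental
  have := hR.simple.1
  let Q := T.squareSplitting ⟨T.toSquare_injective hR.simple hR.constants,
    PPV.ThetaRing.toSquare_surjective hY hgen⟩
  have hε := Q.algebraMap_augmentation hR.simple hR.constants
  rw [PPV.isInfinitesimal_iff (Q.corepresentableBy hR.simple hR.constants)]
  constructor
  · intro hE
    have : Module.Finite F R := by
      -- `R` inherits integrality from `E`; being generated by finitely many elements, it is finite
      -- over `F`.
      have : Algebra.IsIntegral F R := ⟨fun r =>
        (isIntegral_algHom_iff (IsScalarTower.toAlgHom F R E) (IsFractionRing.injective R E)).1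
          (IsPurelyInseparable.isIntegral' F _)⟩
      have hfin : ({r | ∃ p q, r = Y p q} ∪
          {(((Matrix.GeneralLinearGroup.det Y)⁻¹ : Rˣ) : R)} : Set R).Finite := by
        refine Set.Finite.union ?_ (Set.finite_singleton _)
        refine (Set.finite_range fun pq : Fin n × Fin n => Y pq.1 pq.2).subset ?_
        rintro _ ⟨p, q, rfl⟩
        exact ⟨(p, q), rfl⟩
      have : Algebra.FiniteType F R := ⟨Subalgebra.fg_def.2 ⟨_, hfin, hgen⟩⟩
      exact Algebra.IsIntegral.finite
    have hC : Module.Finite K T.squareConstants := Q.finite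
    refine ⟨hC, ?_⟩
    -- In a Noetherian ring the nilradical is nilpotent, so it remains to see that the augmentation
    -- ideal is nil.
    have : IsNoetherianRing T.squareConstants := IsNoetherianRing.of_finite K _
    obtain ⟨m, hm⟩ := IsNoetherianRing.isNilpotent_nilradical T.squareConstants
    refine ⟨m, le_bot_iff.1 ((Ideal.pow_right_mono ?_ m).trans hm.le)⟩
    intro c hc
    -- The augmentation is induced by multiplication, so `c` lies in the nil kernel inside `R ⊗[F]
    -- R`; nilpotency then descends to the subring of constants.
    have hnil : IsNilpotent (Q.equiv (1 ⊗ₜ c)) := by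
      refine PPV.ker_lmul'_le_nilradical E ?_
      rw [RingHom.mem_ker, ← hε, RingHom.mem_ker.1 hc, map_zero]
    have hval : Q.equiv (1 ⊗ₜ c) = (c : R ⊗[F] R) := T.toSquare_one_tmul c
    rw [hval] at hnil
    exact (IsNilpotent.map_iff (f := T.squareConstants.val) Subtype.val_injective).1 hnil
  · rintro ⟨-, m, hm⟩
    refine PPV.isPurelyInseparable_of_ker_lmul'_le_nilradical E
      (Q.ker_lmul'_le_nilradical _ hε fun c hc => ⟨m, ?_⟩)
    have := Ideal.pow_mem_pow hc m
    rwa [hm] at this
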